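/- Let $m:\mathbb N\to\mathbb N$ be polynomially bounded with $m(\lambda)>\lambda$ for all $\lambda$, and for each $\lambda$ let $G:\{0,1\}^{\lambda}\to\{0,1\}^{m(\lambda)}$ and $H:\{0,1\}^{m(\lambda)}\to\{0,1\}^{\lambda}$ be independent uniformly random functions to which all algorithms have quantum oracle access. For $y\in\{0,1\}^\lambda$ let $P_y$ be the point function on $\{0,1\}^\lambda$ with marked input $y$, and let $\mathsf{CP.Protect}^{G,H}(1^\lambda,P_y)$ sample $v\leftarrow\{0,1\}^{m(\lambda)}$ uniformly and output $(|v^{\theta}\rangle,z)$, where $\theta=G(y)$, $z=H(v)$ and $|v^\theta\rangle=(\mathsf{Had}^{\theta_1}\otimes\cdots\otimes \mathsf{Had}^{\theta_{m(\lambda)}})|v\rangle$ with $\mathsf{Had}$ the one-qubit Hadamard gate; as a mixed state, $$\mathsf{CP.Protect}^{G,H}(1^\lambda,P_y)=2^{-m(\lambda)}\sum_{v\in\{0,1\}^{m(\lambda)}}|v^{G(y)}\rangle\langle v^{G(y)}|\otimes|H(v)\rangle\langle H(v)|.$$ A QPT oracle algorithm is a family of quantum oracle circuits (gates from a fixed universal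 finite gate set, measurements, and query gates $O^G$, $O^H$) whose descriptions are generated in classical polynomial time from the security parameter $\lambda$, the oracle length $m(\lambda)$ and the number of input qubits, all in unary. Let $\mathcal D_{\mathsf{PF\text{-}UNP}}$ be the class of ensembles $D=\{D_\lambda\}$, with $D_\lambda$ a distribution over point functions on $\{0,1\}^\lambda$, for which there is $\epsilon>0$ such that for all $\lambda$ the marked input $y$ of $P_y\leftarrow D_\lambda$ has min-entropy $\mathbf H_{\min}(y)\ge\lambda^\epsilon$. For ensembles of states $\rho_\lambda^{G,H},\sigma_\lambda^{G,H}$ on polynomially many qubits, write $\rho^{G,H}_\lambda\approx_c\sigma^{G,H}_\lambda$ if for every QPT oracle distinguisher $\mathcal A$ with single-bit output, every polynomially bounded $q$ and every family of $q(\lambda)$-qubit auxiliary states $\nu_\lambda$ (not depending on the oracles), the quantity $$\mathbb E_{G,H}\Big|\Pr[\mathcal A^{G,H}(\rho_\lambda^{G,H}\otimes\nu_\lambda)=1]-\Pr[\mathcal A^{G,H}(\sigma_\lambda^{G,H}\otimes\nu_\lambda)=1]\Big|$$ is negligible in $\lambda$. Then: 1. $\mathsf{CP.Protect}$ is implemented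 exactly by a QPT oracle algorithm. 2. $\mathsf{CP.Protect}$ satisfies distributional indistinguishability in the quantum random oracle model for the class $\mathcal D_{\mathsf{PF\text{-}UNP}}$: there is a QPT oracle algorithm $\mathsf{Sim}$, which receives only $1^\lambda$ and the public parameters (in particular neither $y$ nor any quantum input), such that for every $D\in\mathcal D_{\mathsf{PF\text{-}UNP}}$ $$\mathbb E_{P_y\leftarrow D_\lambda}\mathsf{CP.Protect}^{G,H}(1^\lambda,P_y)\;\approx_c\;\mathsf{Sim}^{G,H}(1^\lambda).$$ 3. For every $D\in\mathcal D_{\mathsf{PF\text{-}UNP}}$, the averaged protected program is computationally indistinguishable from the maximally mixed state: $$\mathbb E_{P_y\leftarrow D_\lambda}\mathsf{CP.Protect}^{G,H}(1^\lambda,P_y)\;\approx_c\;\frac{\mathbb 1}{2^{m(\lambda)+\lambda}}.$$ -/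

import Mathlib

open scoped BigOperators ComplexOrder

/-! Qubit registers. The computational basis of a register with wire set `W` is `W → Bool`; states and
operators are complex matrices indexed by that basis. -/

/-- Operators (in particular density matrices) on a register of `k` qubits. -/
abbrev QOp (k : ℕ) := Matrix (Fin k → Bool) (Fin k → Bool) ℂ

/-- `ρ` is a (mixed) quantum state: positive semidefinite of unit trace. -/
def IsQState {k : ℕ} (ρ : QOp k) : Prop := ρ.PosSemidef ∧ ρ.trace = 1

/-- The computational basis vector `|x⟩`. -/
def ket {k : ℕ} (x : Fin k → Bool) : (Fin k → Bool) → ℂ := Pi.single x 1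

/-- The rank-one operator `|ψ⟩⟨ψ|`. -/
def ketbra {k : ℕ} (ψ : (Fin k → Bool) → ℂ) : QOp k := Matrix.vecMulVec ψ (star ψ)

/-- The tensor product `ρ ⊗ σ`: the wires of `ρ` come first. -/
def tens {k l : ℕ} (ρ : QOp k) (σ : QOp l) : QOp (k + l) := fun b c =>
  ρ (fun i => b (Fin.castAdd l i)) (fun i => c (Fin.castAdd l i)) *
    σ (fun j => b (Fin.natAdd k j)) (fun j => c (Fin.natAdd k j))

/-- The maximally mixed state on `k` qubits. -/
noncomputable def maxMixed (k : ℕ) : QOp k := ((2 : ℂ) ^ k)⁻¹ • (1 : QOp k)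

/-- The one-qubit Hadamard matrix. -/
noncomputable def hadamard : Matrix Bool Bool ℂ := fun x y =>
  if x && y then -((Real.sqrt 2 : ℝ) : ℂ)⁻¹ else ((Real.sqrt 2 : ℝ) : ℂ)⁻¹

/-- The one-qubit `T` gate `diag(1, exp(iπ/4))`. -/
noncomputable def tMatrix : Matrix Bool Bool ℂ :=
  Matrix.diagonal fun x => if x then Complex.exp (Complex.I * (Real.pi / 4)) else 1

/-- The bit flip. -/
def notMatrix : Matrix Bool Bool ℂ := fun x y => if x = y then 0 else 1

/-- The controlled version of a one-qubit gate: qubit `0` is the control and qubit `1` the target. -/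
def controlled (U : Matrix Bool Bool ℂ) : QOp 2 := fun b c =>
  if b 0 = c 0 then (if b 0 then U (b 1) (c 1) else if b 1 = c 1 then 1 else 0) else 0

/-- The oracle unitary `O^f : |x⟩|y⟩ ↦ |x⟩|y ⊕ f(x)⟩`. -/
def oracleMatrix {k l : ℕ} (f : (Fin k → Bool) → (Fin l → Bool)) :
    Matrix (Fin k ⊕ Fin l → Bool) (Fin k ⊕ Fin l → Bool) ℂ := fun b c =>
  if b = Sum.elim (fun i => c (Sum.inl i))
      (fun j => xor (c (Sum.inr j)) (f (fun i => c (Sum.inl i)) j))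
  then 1 else 0

open Classical in
/-- `M` applied to the wires selected by `e`, and the identity on all other wires. -/
noncomputable def onWires {κ : Type} {w : ℕ} (e : κ ↪ Fin w)
    (M : Matrix (κ → Bool) (κ → Bool) ℂ) : QOp w := fun b c =>
  if ∀ i, i ∉ Set.range e → b i = c i then M (fun j => b (e j)) (fun j => c (e j)) else 0

/-- A one-qubit gate `U` on wire `i`. -/
noncomputable def onWire {w : ℕ} (i : Fin w) (U : Matrix Bool Bool ℂ) : QOp w :=
  onWires (κ := Unit) ⟨fun _ => i, fun _ _ _ => rfl⟩ (fun b c => U (b ()) (c ()))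

open Classical in
/-- The partial trace over all wires outside the range of `e`. -/
noncomputable def reduceTo {k w : ℕ} (e : Fin k ↪ Fin w) (ρ : QOp w) : QOp k := fun x y =>
  ∑ b : Fin w → Bool, ∑ c : Fin w → Bool,
    if (∀ j, b (e j) = x j) ∧ (∀ j, c (e j) = y j) ∧ (∀ i, i ∉ Set.range e → b i = c i)
    then ρ b c else 0

/-! Quantum circuits with two oracles `G : {0,1}^n → {0,1}^m` and `H : {0,1}^m → {0,1}^n`. -/

/-- `{0,1}^k → {0,1}^l`. -/
abbrev BoolFun (k l : ℕ) := (Fin k → Bool) → (Fin l → Bool)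

/-- Elementary operations on `w` wires: the gates Hadamard, `T`, CNOT and controlled Hadamard, the
measurement of a wire in the computational basis, and the query gates `O^G` and `O^H`. -/
inductive Gate (n m w : ℕ) : Type
  | had (i : Fin w)
  | tgate (i : Fin w)
  | cnot (e : Fin 2 ↪ Fin w)
  | chad (e : Fin 2 ↪ Fin w)
  | meas (i : Fin w)
  | queryG (e : Fin n ⊕ Fin m ↪ Fin w)
  | queryH (e : Fin m ⊕ Fin n ↪ Fin w)

/-- The action of an elementary operation on density matrices. The outcome of a measurement stays on
the measured wire. -/
noncomputable def Gate.act {n m w : ℕ} (G : BoolFun n m) (H : BoolFun m n) :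
    Gate n m w → QOp w → QOp w
  | .had i, ρ => onWire i hadamard * ρ * (onWire i hadamard).conjTranspose
  | .tgate i, ρ => onWire i tMatrix * ρ * (onWire i tMatrix).conjTranspose
  | .cnot e, ρ => onWires e (controlled notMatrix) * ρ *
      (onWires e (controlled notMatrix)).conjTranspose
  | .chad e, ρ => onWires e (controlled hadamard) * ρ *
      (onWires e (controlled hadamard)).conjTranspose
  | .meas i, ρ => fun b c => if b i = c i then ρ b c else 0
  | .queryG e, ρ => onWires e (oracleMatrix G) * ρ * (onWires e (oracleMatrix G)).conjTranspose
  | .queryH e, ρ => onWires e (oracleMatrix H) * ρ * (onWires e (oracleMatrix H)).conjTranspose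

/-- A circuit with `a` input qubits and `o` output qubits: the input occupies the first `a` wires and is
followed by `anc` ancillas in state `|0⟩`; all wires except the output wires are discarded at the end. -/
structure Circuit (n m a o : ℕ) where
  anc : ℕ
  gates : List (Gate n m (a + anc))
  out : Fin o ↪ Fin (a + anc)

/-- The output state of a circuit with oracles `G`, `H` on input `ρ`. -/
noncomputable def Circuit.run {n m a o : ℕ} (C : Circuit n m a o) (G : BoolFun n m) (H : BoolFun m n)
    (ρ : QOp a) : QOp o :=
  reduceTo C.out (C.gates.foldl (fun σ g => g.act G H σ)
    (tens ρ (ketbra (ket (fun _ : Fin C.anc => false)))))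

/-! The description of a circuit as a bit string. -/

/-- Self-delimiting unary code of a number. -/
def unary (k : ℕ) : List Bool := List.replicate k true ++ [false]

/-- Unary codes of a sequence of wires. -/
def wiresCode {k w : ℕ} (e : Fin k → Fin w) : List Bool :=
  (List.ofFn e).flatMap fun i => unary i.val

def Gate.code {n m w : ℕ} : Gate n m w → List Bool
  | .had i => unary 0 ++ unary i.val
  | .tgate i => unary 1 ++ unary i.val
  | .cnot e => unary 2 ++ wiresCode e
  | .chad e => unary 3 ++ wiresCode e
  | .meas i => unary 4 ++ unary i.val
  | .queryG e => unary 5 ++ wiresCode (fun i => e (Sum.inl i)) ++ wiresCode (fun j => e (Sum.inr j))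
  | .queryH e => unary 6 ++ wiresCode (fun i => e (Sum.inl i)) ++ wiresCode (fun j => e (Sum.inr j))

def Circuit.code {n m a o : ℕ} (C : Circuit n m a o) : List Bool :=
  unary C.anc ++ C.gates.flatMap Gate.code ++ unary 7 ++ wiresCode C.out

/-! Classical polynomial time: while programs on finitely many stacks of bits with a write-only output
tape (that is, multi-stack machines, which are polynomially equivalent to Turing machines). -/

/-- Programs; stacks are named by natural numbers. -/
inductive Prog : Type
  | skip
  | print (b : Bool)
  | push (r : ℕ) (b : Bool)
  | pop (r : ℕ)
  | seq (p q : Prog)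
  | branch (r : ℕ) (pEmpty pFalse pTrue : Prog)
  | loop (r : ℕ) (p : Prog)

/-- Contents of the stacks (top first) and of the output tape. -/
structure ProgState where
  stack : ℕ → List Bool
  output : List Bool

/-- `Runs p s s' t`: started in `s`, the program `p` halts in `s'` after `t` steps. `branch` inspects the
top of stack `r`, and `loop r p` repeats `p` as long as the top of stack `r` is the bit `true`. -/
inductive Runs : Prog → ProgState → ProgState → ℕ → Prop
  | skip (s) : Runs .skip s s 1
  | print (b s) : Runs (.print b) s ⟨s.stack, s.output ++ [b]⟩ 1
  | push (r b s) : Runs (.push r b) s ⟨Function.update s.stack r (b :: s.stack r), s.output⟩ 1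
  | pop (r s) : Runs (.pop r) s ⟨Function.update s.stack r (s.stack r).tail, s.output⟩ 1
  | seq {p q s₁ s₂ s₃ t u} : Runs p s₁ s₂ t → Runs q s₂ s₃ u → Runs (.seq p q) s₁ s₃ (t + u)
  | branchEmpty {r p₀ p₁ p₂ s s' t} : (s.stack r).head? = none → Runs p₀ s s' t →
      Runs (.branch r p₀ p₁ p₂) s s' (t + 1)
  | branchFalse {r p₀ p₁ p₂ s s' t} : (s.stack r).head? = some false → Runs p₁ s s' t →
      Runs (.branch r p₀ p₁ p₂) s s' (t + 1)
  | branchTrue {r p₀ p₁ p₂ s s' t} : (s.stack r).head? = some true → Runs p₂ s s' t →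
      Runs (.branch r p₀ p₁ p₂) s s' (t + 1)
  | loopDone {r p s} : (s.stack r).head? ≠ some true → Runs (.loop r p) s s 1
  | loopStep {r p s₁ s₂ s₃ t u} : (s₁.stack r).head? = some true → Runs p s₁ s₂ t →
      Runs (.loop r p) s₂ s₃ u → Runs (.loop r p) s₁ s₃ (t + u + 1)

/-- The initial state: stacks `0`, `1`, `2` hold `1^n`, `1^m`, `1^a`; everything else is empty. -/
def initState (n m a : ℕ) : ProgState where
  stack r := match r with
    | 0 => List.replicate n true
    | 1 => List.replicate m true
    | 2 => List.replicate a true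
    | _ => []
  output := []

/-- From `1^n, 1^m, 1^a` the string `f n m a` can be printed in time polynomial in `n + m + a`. -/
def PolyTimePrintable (f : ℕ → ℕ → ℕ → List Bool) : Prop :=
  ∃ (P : Prog) (p : Polynomial ℕ), ∀ n m a, ∃ (s : ProgState) (t : ℕ),
    Runs P (initState n m a) s t ∧ t ≤ p.eval (n + m + a) ∧ s.output = f n m a

/-- A QPT oracle algorithm: a polynomial-time uniform family of oracle circuits. It gets, in unary, the
security parameter `n`, the length `m` that (together with `n`) fixes the sizes of its oracles
`G : {0,1}^n → {0,1}^m`, `H : {0,1}^m → {0,1}^n`, and the number `a` of its input qubits;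
it outputs `o n m a` qubits. -/
structure QPTAlgorithm (o : ℕ → ℕ → ℕ → ℕ) where
  circ : ∀ n m a : ℕ, Circuit n m a (o n m a)
  uniform : PolyTimePrintable fun n m a => (circ n m a).code

noncomputable def QPTAlgorithm.run {o : ℕ → ℕ → ℕ → ℕ} (A : QPTAlgorithm o) {n m a : ℕ}
    (G : BoolFun n m) (H : BoolFun m n) (ρ : QOp a) : QOp (o n m a) :=
  (A.circ n m a).run G H ρ

/-- An algorithm with single-bit output. -/
abbrev QPTDistinguisher := QPTAlgorithm fun _ _ _ => 1

/-- The probability that the single output bit is `1`. -/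
noncomputable def QPTAlgorithm.prOne (A : QPTDistinguisher) {n m a : ℕ}
    (G : BoolFun n m) (H : BoolFun m n) (ρ : QOp a) : ℝ :=
  (A.run G H ρ (fun _ => true) (fun _ => true)).re

/-! Asymptotics, indistinguishability, obfuscation. -/

def PolyBounded (f : ℕ → ℕ) : Prop := ∃ p : Polynomial ℕ, ∀ n, f n ≤ p.eval n

/-- `μ(n) = o(1/p(n))` for every polynomial `p`. -/
def Negligible (μ : ℕ → ℝ) : Prop :=
  Asymptotics.SuperpolynomialDecay Filter.atTop (fun n : ℕ => (n : ℝ)) μ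

/-- Computational indistinguishability in the quantum random oracle model of two ensembles of
`p n`-qubit states that depend on uniformly random oracles `G`, `H`; the auxiliary states do not depend on
the oracles. -/
def CompIndistQROM (m p : ℕ → ℕ) (ρ σ : ∀ n, BoolFun n (m n) → BoolFun (m n) n → QOp (p n)) : Prop :=
  ∀ (A : QPTDistinguisher) (q : ℕ → ℕ), PolyBounded q →
    ∀ ν : ∀ n, QOp (q n), (∀ n, IsQState (ν n)) →
      Negligible fun n => 𝔼 G : BoolFun n (m n), 𝔼 H : BoolFun (m n) n,
        |A.prOne G H (tens (ρ n G H) (ν n)) - A.prOne G H (tens (σ n G H) (ν n))|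

/-- An ensemble of distributions over point functions on `{0,1}^n`; the point function with marked input
`y` is given by `y`. -/
abbrev PFEnsemble := ∀ n : ℕ, PMF (Fin n → Bool)

/-- Min-entropy. -/
noncomputable def minEntropy {k : ℕ} (D : PMF (Fin k → Bool)) : ℝ :=
  -Real.logb 2 (⨆ y, (D y).toReal)

/-- The class of unpredictable point function distributions. -/
def UnpredictablePF : Set PFEnsemble :=
  {D | ∃ ε : ℝ, 0 < ε ∧ ∀ n : ℕ, (n : ℝ) ^ ε ≤ minEntropy (D n)}

/-- The expectation of the output state `ρ y` over `y ← D`. -/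
noncomputable def avgState {n k : ℕ} (D : PMF (Fin n → Bool)) (ρ : (Fin n → Bool) → QOp k) : QOp k :=
  ∑ y, (((D y).toReal : ℝ) : ℂ) • ρ y

/-- Distributional indistinguishability in the QROM of an obfuscator `Obf` of point functions, for a class
`𝒟` of ensembles: one QPT simulator, which gets the security parameter (which is also the input length of
the point function) and the oracles but no quantum input, works for all ensembles in the class. The
simulator and `Obf` output `p n (m n)` qubits. -/
def DistributionallyIndistinguishable (m : ℕ → ℕ) (p : ℕ → ℕ → ℕ)
    (Obf : ∀ n, BoolFun n (m n) → BoolFun (m n) n → (Fin n → Bool) → QOp (p n (m n)))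
    (𝒟 : Set PFEnsemble) : Prop :=
  ∃ Sim : QPTAlgorithm (fun n k _ => p n k), ∀ D ∈ 𝒟,
    CompIndistQROM m (fun n => p n (m n))
      (fun n G H => avgState (D n) (Obf n G H))
      (fun _ G H => Sim.run G H (1 : QOp 0))

/-- The operator `H^θ`, the tensor product of the `H^{θ i}`. -/
noncomputable def hadamardPow {m : ℕ} (θ : Fin m → Bool) : QOp m := fun x y =>
  ∏ i, (if θ i then hadamard else 1) (x i) (y i)

/-- `|v^θ⟩ = H^θ |v⟩`. -/
noncomputable def bb84 {m : ℕ} (v θ : Fin m → Bool) : (Fin m → Bool) → ℂ :=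
  (hadamardPow θ).mulVec (ket v)

/-- The output state of `CP.Protect^{G,H}(1^n, y)`: sample `v ← {0,1}^m` uniformly and output
`(|v^θ⟩, z)` with `θ = G(y)`, `z = H(v)`. -/
noncomputable def cpProtect {n m : ℕ} (G : BoolFun n m) (H : BoolFun m n) (y : Fin n → Bool) :
    QOp (m + n) :=
  ((2 : ℂ) ^ m)⁻¹ • ∑ v : Fin m → Bool, tens (ketbra (bb84 v (G y))) (ketbra (ket (H v)))

/-!
Let `O = (G, H)`, and let `X(O)` be the advantage of a distinguisher `A` in telling the averaged protected
program from the maximally mixed state when the oracles are `O`. The heart of the matter is that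
`𝔼_O |X(O)|` is negligible. The absolute value inside the expectation rules out the usual comparison of
two averaged experiments; instead the second moment `𝔼_O X(O) ^ 2` is bounded, and `|X| ≤ s + X ^ 2 / s`
gives the first absolute moment (`Circuit.expect_sq_le`, `Circuit.expect_abs_le`).

*Lazy sampling.* `X(O)` is the mean of `adv_O(y, v, G(y), H(v))` over `y` and `v`, where `adv_O(x)` is the
advantage on the state `|v^θ⟩|z⟩` of a sample `x = (y, v, θ, z)`. In `X(O) ^ 2` there are two such samples.
Since `O` is random, the answers `θ` and `z` may be chosen independently and uniformly if the oracles are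
reprogrammed at `y` and `v` (`expect_readSample`). So `𝔼_O X(O) ^ 2` equals
`𝔼 adv_{O[x, x']}(x) * adv_{O[x, x']}(x')`, up to the event that `x` and `x'` collide in `y` or in `v`, for
independent `O`, `x`, `x'`. Without the reprogramming this is `(𝔼_x adv_O(x)) ^ 2 = 0` for each `O`, because
the average of `|v^θ⟩⟨v^θ| ⊗ |z⟩⟨z|` over `v` and `z` is the maximally mixed state
(`Circuit.sampleMean_adv`).

*Reprogramming.* By the hybrid argument (`abs_gatesLin_sub_le`), the reprogramming goes unnoticed unless `A`
puts considerable query weight on the points `y`, `v`, `y'`, `v'` while it runs with the original oracles.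
Instead of the trace norm the argument uses linear functionals that lie between `0` and the trace on positive
operators (`IsEffect`), for which the inequality `(B + D) ρ (B + D)ᴴ ≤ (1 + s²) B ρ Bᴴ + (1 + s⁻²) D ρ Dᴴ`
takes the place of the Cauchy–Schwarz inequality.

*Guessing.* In a run with the original oracles on the state of `x`, the points `y'` and `v'` are independent
of the run, and so is `y`, on which the state does not depend; the min-entropy of `y` and the size of
`{0,1}^m` bound these weights. The state does depend on `v`, but it is encoded in an unknown uniformly random
basis: averaging the qubit `Had^θ |b⟩` over `θ` gives an operator with norm `cos² (π / 8)`, so no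
measurement predicts `v` with probability above `cos² (π / 8) ^ m` (`expect_guess_le`). Since `A` makes
polynomially many queries (`QPTAlgorithm.exists_gates_length_le`), all weights are negligible.

The simulator measures qubits in the state `Had |0⟩` and thus outputs the maximally mixed state exactly. The
circuit for the protection computes `θ = G(y)`, samples `v` in the same way as the simulator, computes
`z = H(v)` and applies Hadamard gates to `v` controlled by `θ`; before these last gates the register is in a
mixture of basis states, and all states are tensor products of one-qubit operators. Both circuits are
lists of loops over the parameters, and programs that print such lists are assembled by the combinators for
`Printable`.
-/


/-! ### Programs that print strings described by loops -/

/-- The machine state whose stack `r` holds `c r` in unary and whose output tape holds `o`. -/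
def tally (c : ℕ → ℕ) (o : List Bool) : ProgState := ⟨fun r => List.replicate (c r) true, o⟩

theorem tally_push (c : ℕ → ℕ) (o : List Bool) (r : ℕ) :
    Runs (.push r true) (tally c o) (tally (Function.update c r (c r + 1)) o) 1 := by
  have h := Runs.push r true (tally c o)
  convert h using 1
  simp only [tally, ProgState.mk.injEq, and_true]
  funext s
  by_cases hs : s = r
  · subst hs; simp [List.replicate_succ]
  · simp [Function.update_of_ne hs]

theorem tally_pop (c : ℕ → ℕ) (o : List Bool) (r : ℕ) :
    Runs (.pop r) (tally c o) (tally (Function.update c r (c r - 1)) o) 1 := by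
  have h := Runs.pop r (tally c o)
  convert h using 1
  simp only [tally, ProgState.mk.injEq, and_true]
  funext s
  by_cases hs : s = r
  · subst hs; simp
  · simp [Function.update_of_ne hs]

theorem tally_head (c : ℕ → ℕ) (o : List Bool) (r : ℕ) :
    ((tally c o).stack r).head? = some true ↔ c r ≠ 0 := by
  rcases h : c r with _ | k <;> simp [tally, h, List.replicate_succ]

/-- A loop whose body leads from `st k` to `st (k + 1)` for `k < N`, and whose guard fails at `st N`. -/
theorem Runs.loop_iterate {r : ℕ} {P : Prog} {B : ℕ} (N : ℕ) :
    ∀ st : ℕ → ProgState, ((st N).stack r).head? ≠ some true →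
      (∀ k < N, ((st k).stack r).head? = some true ∧ ∃ t ≤ B, Runs P (st k) (st (k + 1)) t) →
      ∃ t ≤ N * (B + 1) + 1, Runs (.loop r P) (st 0) (st N) t := by
  induction N with
  | zero => intro st h0 _; exact ⟨1, by simp, .loopDone h0⟩
  | succ N ih =>
    intro st hN hs
    obtain ⟨h0, t, ht, hr⟩ := hs 0 (Nat.succ_pos N)
    obtain ⟨u, hu, hr'⟩ := ih (fun k => st (k + 1)) hN (fun k hk => hs (k + 1) (by omega))
    exact ⟨t + u + 1, by rw [Nat.succ_mul]; omega, .loopStep h0 hr hr'⟩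

/-- The register contents used by the printing programs: the parameters in the registers `0`, `1`, `2`,
the loop index in `3`, a scratch register `4`, and the number of remaining iterations in `5`. -/
def cnt (n m a i j k : ℕ) : ℕ → ℕ
  | 0 => n
  | 1 => m
  | 2 => a
  | 3 => i
  | 4 => j
  | 5 => k
  | _ => 0

/-- Some program prints `f n m a i` in polynomial time and restores the registers, where `i` is the value
of the loop index and `k` the number of remaining iterations, subject to `S (n + m + a) i k`. -/
def Printable (S : ℕ → ℕ → ℕ → Prop) (f : ℕ → ℕ → ℕ → ℕ → List Bool) : Prop :=
  ∃ (P : Prog) (p : Polynomial ℕ), ∀ n m a i k, S (n + m + a) i k → ∀ o,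
    ∃ t ≤ p.eval (n + m + a),
      Runs P (tally (cnt n m a i 0 k) o) (tally (cnt n m a i 0 k) (o ++ f n m a i)) t

/-- The constraint inside the body of a loop. -/
def InLoop (N i _k : ℕ) : Prop := i ≤ N

/-- The constraint outside of all loops. -/
def OutsideLoops (_N i k : ℕ) : Prop := i = 0 ∧ k = 0

section Printable

variable {S : ℕ → ℕ → ℕ → Prop}

theorem Printable.append {f g : ℕ → ℕ → ℕ → ℕ → List Bool} (hf : Printable S f)
    (hg : Printable S g) : Printable S fun n m a i => f n m a i ++ g n m a i := by
  obtain ⟨P, p, hP⟩ := hf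
  obtain ⟨Q, q, hQ⟩ := hg
  refine ⟨.seq P Q, p + q, fun n m a i k hS o => ?_⟩
  obtain ⟨t, ht, hr⟩ := hP n m a i k hS o
  obtain ⟨u, hu, hr'⟩ := hQ n m a i k hS (o ++ f n m a i)
  refine ⟨t + u, by rw [Polynomial.eval_add]; omega, ?_⟩
  rw [← List.append_assoc]
  exact .seq hr hr'

theorem Printable.lit (l : List Bool) : Printable S fun _ _ _ _ => l := by
  induction l with
  | nil => exact ⟨.skip, 1, fun n m a i k _ o => ⟨1, by simp, by simpa using Runs.skip _⟩⟩
  | cons b l ih =>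
    have hb : Printable S fun _ _ _ _ => [b] :=
      ⟨.print b, 1, fun n m a i k _ o => ⟨1, by simp, Runs.print b _⟩⟩
    exact hb.append ih

/-- Moving the contents of register `r` to register `s`, executing `P` once for each unit moved. -/
theorem tally_move {P : Prog} {r s : ℕ} (hrs : r ≠ s) {B : ℕ} (l : List Bool)
    (c : ℕ → ℕ → ℕ) (N : ℕ) (hN : c N r = 0) (hpos : ∀ j < N, c j r ≠ 0) (o : List Bool)
    (hP : ∀ j < N, ∀ o, ∃ t ≤ B, Runs P
      (tally (Function.update (Function.update (c j) r (c j r - 1)) s (c j s + 1)) o)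
      (tally (c (j + 1)) (o ++ l)) t) :
    ∃ t ≤ N * (B + 3) + 1, Runs (.loop r (.seq (.pop r) (.seq (.push s true) P)))
      (tally (c 0) o) (tally (c N) (o ++ (List.replicate N l).flatten)) t := by
  have := Runs.loop_iterate (r := r) (B := B + 2) (P := .seq (.pop r) (.seq (.push s true) P)) N
    (fun j => tally (c j) (o ++ (List.replicate j l).flatten)) (by rw [ne_eq, tally_head]; simpa)
    (fun j hj => ⟨(tally_head _ _ _).2 (hpos j hj), by
      obtain ⟨t, ht, hr⟩ := hP j hj (o ++ (List.replicate j l).flatten)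
      refine ⟨1 + (1 + t), by omega, .seq (tally_pop _ _ _) (.seq (tally_push _ _ _) ?_)⟩
      rw [Function.update_of_ne hrs.symm]
      convert hr using 2
      rw [List.append_assoc, List.replicate_succ', List.flatten_append]
      simp⟩)
  simpa using this

/-- Printing a register in unary. The register is emptied into the scratch register, with one symbol
printed for each unit, and then restored. -/
theorem Printable.reg (r : ℕ) (hr : r < 4) (hS : ∀ N i k, S N i k → i ≤ N) :
    Printable S fun n m a i => List.replicate (cnt n m a i 0 0 r) true := by
  refine ⟨.seq (.loop r (.seq (.pop r) (.seq (.push 4 true) (.print true))))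
    (.loop 4 (.seq (.pop 4) (.seq (.push r true) .skip))),
    Polynomial.X * 8 + 2, fun n m a i k h o => ?_⟩
  have hi := hS _ _ _ h
  have hle : cnt n m a i 0 0 r ≤ n + m + a := by
    interval_cases r <;> simp only [cnt] <;> omega
  have hck : cnt n m a i 0 0 r = cnt n m a i 0 k r := by interval_cases r <;> rfl
  set N := cnt n m a i 0 0 r with hNdef
  obtain ⟨t, ht, h1⟩ := tally_move (r := r) (s := 4) (P := .print true) (by omega) (B := 1) [true]
    (fun j => Function.update (Function.update (cnt n m a i 0 k) r (N - j)) 4 j) N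
    (by simp [show r ≠ 4 by omega]) (fun j hj => by simp [show r ≠ 4 by omega]; omega) o
    (fun j hj o => ⟨1, le_rfl, by
      convert Runs.print true _ using 1
      simp only [tally]
      congr 1
      funext q
      congr 1
      by_cases h4 : q = 4
      · subst h4; simp
      · by_cases hq : q = r
        · subst hq; simp [h4]; omega
        · simp [h4, hq]⟩)
  obtain ⟨u, hu, h2⟩ := tally_move (r := 4) (s := r) (P := .skip) (by omega) (B := 1) []
    (fun j => Function.update (Function.update (cnt n m a i 0 k) r j) 4 (N - j)) N
    (by simp) (fun j hj => by simp; omega)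
    (o ++ (List.replicate N [true]).flatten)
    (fun j hj o => ⟨1, le_rfl, by
      convert Runs.skip _ using 1
      simp only [tally, List.append_nil]
      congr 1
      funext q
      congr 1
      by_cases h4 : q = 4
      · subst h4; simp [show (4:ℕ) ≠ r by omega]; omega
      · by_cases hq : q = r
        · subst hq; simp [h4]
        · simp [h4, hq]⟩)
  refine ⟨t + u, ?_, ?_⟩
  · simp only [Polynomial.eval_add, Polynomial.eval_mul, Polynomial.eval_X, Polynomial.eval_ofNat]
    omega
  · convert Runs.seq h1 (by convert h2 using 2; simp) using 2
    · funext q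
      by_cases h4 : q = 4
      · subst h4; simp [cnt]
      · by_cases hq : q = r
        · subst hq; simp [h4, hck]
        · simp [h4, hq]
    · funext q
      by_cases h4 : q = 4
      · subst h4; simp [cnt]
      · by_cases hq : q = r
        · subst hq; simp [h4, hck]
        · simp [h4, hq]
    · simp [← hNdef]

/-- Loops: the strings `f n m a i` for all `i` below the parameter in register `r`. The parameter is
copied to the register of remaining iterations, by way of the scratch register; each iteration moves one
unit from there to the loop index. -/
theorem Printable.forLoop {f : ℕ → ℕ → ℕ → ℕ → List Bool} (hf : Printable InLoop f) (r : ℕ)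
    (hr : r < 3) :
    Printable OutsideLoops fun n m a _ => (List.range (cnt n m a 0 0 0 r)).flatMap (f n m a) := by
  obtain ⟨P, p, hP⟩ := hf
  refine ⟨.seq (.loop r (.seq (.pop r) (.seq (.push 4 true) (.push 5 true))))
    (.seq (.loop 4 (.seq (.pop 4) (.seq (.push r true) .skip)))
    (.seq (.loop 5 (.seq P (.seq (.pop 5) (.push 3 true)))) (.loop 3 (.pop 3)))),
    Polynomial.X * (p + 20) + 20, ?_⟩
  rintro n m a _ _ ⟨rfl, rfl⟩ o
  have hle : cnt n m a 0 0 0 r ≤ n + m + a := by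
    interval_cases r <;> simp only [cnt] <;> omega
  set N := cnt n m a 0 0 0 r with hNdef
  obtain ⟨t, ht, h1⟩ := tally_move (r := r) (s := 4) (P := .push 5 true) (by omega) (B := 1) []
    (fun j => Function.update (cnt n m a 0 j j) r (N - j)) N
    (by simp) (fun j hj => by simp; omega) o
    (fun j hj o => ⟨1, le_rfl, by
      convert tally_push _ _ _ using 1
      simp only [tally, List.append_nil]
      congr 1
      funext q
      congr 1
      by_cases h4 : q = 4
      · subst h4; simp [cnt, show (4:ℕ) ≠ r by omega]
      · by_cases h5 : q = 5
        · subst h5; simp [cnt, show (5:ℕ) ≠ r by omega]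
        · by_cases hq : q = r
          · subst hq; simp [h4, h5]; omega
          · simp [h4, hq, h5]
            unfold cnt; split <;> simp_all⟩)
  obtain ⟨u, hu, h2⟩ := tally_move (r := 4) (s := r) (P := .skip) (by omega) (B := 1) []
    (fun j => Function.update (cnt n m a 0 (N - j) N) r j) N
    (by simp [cnt, show (4:ℕ) ≠ r by omega])
    (fun j hj => by simp [cnt, show (4:ℕ) ≠ r by omega]; omega) o
    (fun j hj o => ⟨1, le_rfl, by
      convert Runs.skip _ using 1
      simp only [tally, List.append_nil]
      congr 1
      funext q
      congr 1
      by_cases h4 : q = 4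
      · subst h4; simp [cnt, show (4:ℕ) ≠ r by omega]; omega
      · by_cases hq : q = r
        · subst hq; simp
        · simp [h4, hq]
          unfold cnt; split <;> simp_all⟩)
  obtain ⟨v, hv, h3⟩ := Runs.loop_iterate (r := 5) (B := p.eval (n + m + a) + 2)
    (P := .seq P (.seq (.pop 5) (.push 3 true))) N
    (fun j => tally (cnt n m a j 0 (N - j)) (o ++ (List.range j).flatMap (f n m a)))
    (by rw [ne_eq, tally_head]; simp [cnt])
    (fun j hj => ⟨by rw [tally_head]; simp [cnt]; omega, by
      obtain ⟨t, ht, h⟩ := hP n m a j (N - j) (show j ≤ _ by omega)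
        (o ++ (List.range j).flatMap (f n m a))
      refine ⟨t + (1 + 1), by omega, .seq h (.seq (tally_pop _ _ _) ?_)⟩
      convert tally_push _ _ _ using 1
      rw [List.range_succ, List.flatMap_append, List.append_assoc, List.flatMap_singleton]
      congr 1
      funext q
      rcases q with _ | _ | _ | _ | _ | _ | q <;> simp [cnt]
      omega⟩)
  obtain ⟨w, hw, h4⟩ := Runs.loop_iterate (r := 3) (B := 1) (P := .pop 3) N
    (fun j => tally (cnt n m a (N - j) 0 0) (o ++ (List.range N).flatMap (f n m a)))
    (by rw [ne_eq, tally_head]; simp [cnt])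
    (fun j hj => ⟨by rw [tally_head]; simp [cnt]; omega, 1, le_rfl, by
      convert tally_pop _ _ _ using 2
      funext q
      rcases q with _ | _ | _ | _ | _ | _ | q <;> simp [cnt]
      omega⟩)
  have e1 : Function.update (cnt n m a 0 0 0) r N = cnt n m a 0 0 0 := by simp [hNdef]
  have e3 : Function.update (cnt n m a 0 0 N) r N = cnt n m a 0 0 N := by
    funext q
    by_cases hq : q = r
    · subst hq; simp [hNdef]; interval_cases q <;> rfl
    · simp [hq]
  simp only [List.flatten_replicate_nil, List.append_nil, List.range_zero, List.flatMap_nil,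
    Nat.sub_self, Nat.sub_zero] at h1 h2 h3 h4
  rw [e1] at h1
  rw [e3] at h2
  refine ⟨t + (u + (v + w)), ?_, .seq h1 (.seq h2 (.seq h3 h4))⟩
  simp only [Polynomial.eval_add, Polynomial.eval_mul, Polynomial.eval_X, Polynomial.eval_ofNat]
  have := Nat.mul_le_mul_right (p.eval (n + m + a) + 12) hle
  nlinarith

theorem Printable.unary {f : ℕ → ℕ → ℕ → ℕ → ℕ}
    (hf : Printable S fun n m a i => List.replicate (f n m a i) true) :
    Printable S fun n m a i => unary (f n m a i) :=
  hf.append (.lit [false])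

theorem Printable.replicate_add {f g : ℕ → ℕ → ℕ → ℕ → ℕ}
    (hf : Printable S fun n m a i => List.replicate (f n m a i) true)
    (hg : Printable S fun n m a i => List.replicate (g n m a i) true) :
    Printable S fun n m a i => List.replicate (f n m a i + g n m a i) true := by
  simpa only [List.replicate_append_replicate] using hf.append hg

theorem Printable.polyTimePrintable {f : ℕ → ℕ → ℕ → ℕ → List Bool} (hf : Printable OutsideLoops f) :
    PolyTimePrintable fun n m a => f n m a 0 := by
  obtain ⟨P, p, hP⟩ := hf
  refine ⟨P, p, fun n m a => ?_⟩
  obtain ⟨t, ht, h⟩ := hP n m a 0 0 ⟨rfl, rfl⟩ []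
  refine ⟨tally (cnt n m a 0 0 0) ([] ++ f n m a 0), t, ?_, ht, List.nil_append _⟩
  convert h using 1
  simp only [initState, tally, ProgState.mk.injEq, and_true]
  funext r
  rcases r with _ | _ | _ | _ | _ | _ | r <;> simp [cnt]

end Printable

theorem Runs.output_length_le {P : Prog} {s s' : ProgState} {t : ℕ} (h : Runs P s s' t) :
    s'.output.length ≤ s.output.length + t := by
  induction h <;> (try simp only [List.length_append, List.length_singleton] at *) <;> omega

theorem Gate.one_le_code_length {n m w : ℕ} (g : Gate n m w) : 1 ≤ g.code.length := by
  cases g <;> simp [Gate.code, _root_.unary]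

theorem Circuit.gates_length_le_code_length {n m a o : ℕ} (C : Circuit n m a o) :
    C.gates.length ≤ C.code.length := by
  have : ∀ l : List (Gate n m (a + C.anc)), l.length ≤ (l.flatMap Gate.code).length := by
    intro l
    induction l with
    | nil => simp
    | cons g l ih =>
      have := g.one_le_code_length
      simp only [List.length_cons, List.flatMap_cons, List.length_append]
      omega
  have := this C.gates
  simp only [Circuit.code, List.length_append]
  omega

/-- The circuits of a uniform family have polynomially many gates. -/
theorem QPTAlgorithm.exists_gates_length_le {o : ℕ → ℕ → ℕ → ℕ} (A : QPTAlgorithm o) :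
    ∃ p : Polynomial ℕ, ∀ n m a, (A.circ n m a).gates.length ≤ p.eval (n + m + a) := by
  obtain ⟨P, p, hP⟩ := A.uniform
  refine ⟨p, fun n m a => ?_⟩
  obtain ⟨s, t, hr, ht, hs⟩ := hP n m a
  have h1 := hr.output_length_le
  have h2 := (A.circ n m a).gates_length_le_code_length
  rw [hs] at h1
  simp only [initState, List.length_nil, zero_add] at h1
  omega

/-! ### Operators on selected wires -/

section OnWires

variable {κ : Type} {w : ℕ}

open Classical in
/-- Splitting a basis label into its values on the wires selected by `e` and on all other wires. -/
noncomputable def wireSplit (e : κ ↪ Fin w) :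
    (Fin w → Bool) ≃ (κ → Bool) × ({i // i ∉ Set.range e} → Bool) where
  toFun b := (fun j => b (e j), fun i => b i)
  invFun p i := if h : i ∈ Set.range e then p.1 h.choose else p.2 ⟨i, h⟩
  left_inv b := by
    funext i
    by_cases h : i ∈ Set.range e
    · simp only [h, dif_pos]
      exact congrArg b h.choose_spec
    · simp only [h, dif_neg, not_false_eq_true]
  right_inv p := by
    refine Prod.ext ?_ ?_
    · funext j
      have h : e j ∈ Set.range e := ⟨j, rfl⟩
      simp only [h, dif_pos]
      exact congrArg p.1 (e.injective h.choose_spec)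
    · funext i
      simp only [i.2, dif_neg, not_false_eq_true]

open scoped Kronecker in
theorem onWires_eq_submatrix (e : κ ↪ Fin w)
    [DecidableEq ({i // i ∉ Set.range e} → Bool)] (M : Matrix (κ → Bool) (κ → Bool) ℂ) :
    onWires e M = (M ⊗ₖ (1 : Matrix ({i // i ∉ Set.range e} → Bool) _ ℂ)).submatrix
      (wireSplit e) (wireSplit e) := by
  classical
  funext b c
  simp only [onWires, Matrix.submatrix_apply, Matrix.kroneckerMap_apply, Matrix.one_apply,
    wireSplit, Equiv.coe_fn_mk, funext_iff, Subtype.forall]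
  split_ifs <;> simp_all

theorem onWires_conjTranspose (e : κ ↪ Fin w) (M : Matrix (κ → Bool) (κ → Bool) ℂ) :
    (onWires e M).conjTranspose = onWires e M.conjTranspose := by
  classical
  rw [onWires_eq_submatrix, onWires_eq_submatrix, Matrix.conjTranspose_submatrix,
    Matrix.conjTranspose_kronecker, Matrix.conjTranspose_one]

variable [Fintype κ]

theorem onWires_one (e : κ ↪ Fin w) : onWires e (1 : Matrix (κ → Bool) (κ → Bool) ℂ) = 1 := by
  classical
  ext b c
  rw [onWires_eq_submatrix, Matrix.one_kronecker_one, Matrix.submatrix_apply, Matrix.one_apply,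
    Matrix.one_apply]
  simp only [EmbeddingLike.apply_eq_iff_eq]

variable [DecidableEq κ]

theorem onWires_mul (e : κ ↪ Fin w) (M N : Matrix (κ → Bool) (κ → Bool) ℂ) :
    onWires e (M * N) = onWires e M * onWires e N := by
  classical
  rw [onWires_eq_submatrix, onWires_eq_submatrix, onWires_eq_submatrix,
    Matrix.submatrix_mul_equiv, ← Matrix.mul_kronecker_mul, Matrix.one_mul]

theorem onWires_isometry (e : κ ↪ Fin w) {M : Matrix (κ → Bool) (κ → Bool) ℂ}
    (hM : M.conjTranspose * M = 1) : (onWires e M).conjTranspose * onWires e M = 1 := by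
  rw [onWires_conjTranspose, ← onWires_mul, hM, onWires_one]

end OnWires

/-! ### The gates are unitary -/

theorem inv_sqrt_two_mul_self :
    ((Real.sqrt 2 : ℝ) : ℂ)⁻¹ * ((Real.sqrt 2 : ℝ) : ℂ)⁻¹ = 1 / 2 := by
  rw [← mul_inv, ← Complex.ofReal_mul, Real.mul_self_sqrt (by norm_num)]
  norm_num

theorem hadamard_isometry : hadamard.conjTranspose * hadamard = 1 := by
  have h := inv_sqrt_two_mul_self
  have h' : (starRingEnd ℂ) ((Real.sqrt 2 : ℝ) : ℂ)⁻¹ = ((Real.sqrt 2 : ℝ) : ℂ)⁻¹ := by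
    rw [map_inv₀, Complex.conj_ofReal]
  ext x y
  rw [Matrix.mul_apply, Fintype.sum_bool]
  simp only [hadamard, Matrix.conjTranspose_apply]
  generalize ((Real.sqrt 2 : ℝ) : ℂ)⁻¹ = r at h h'
  cases x <;> cases y <;> simp [h, h'] <;> norm_num

theorem tMatrix_isometry : tMatrix.conjTranspose * tMatrix = 1 := by
  have h : (starRingEnd ℂ) (Complex.exp (Complex.I * (Real.pi / 4))) *
      Complex.exp (Complex.I * (Real.pi / 4)) = 1 := by
    rw [← Complex.exp_conj, ← Complex.exp_add]
    simp [map_ofNat]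
  rw [tMatrix, Matrix.diagonal_conjTranspose, Matrix.diagonal_mul_diagonal, ← Matrix.diagonal_one]
  congr 1
  funext x
  cases x <;> simp [h]

theorem notMatrix_isometry : notMatrix.conjTranspose * notMatrix = 1 := by
  ext x y
  rw [Matrix.mul_apply]
  cases x <;> cases y <;> simp [notMatrix, Matrix.conjTranspose_apply]

theorem controlled_isometry {U : Matrix Bool Bool ℂ} (hU : U.conjTranspose * U = 1) :
    (controlled U).conjTranspose * controlled U = 1 := by
  have hU' : ∀ x y, star (U true x) * U true y + star (U false x) * U false y =
      if x = y then 1 else 0 := fun x y => by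
    have := congrFun (congrFun hU x) y
    simpa [Matrix.mul_apply, Matrix.one_apply] using this
  ext x y
  rw [Matrix.mul_apply, ← (finTwoArrowEquiv Bool).symm.sum_comp, Fintype.sum_prod_type]
  simp only [Fintype.sum_bool, controlled, Matrix.conjTranspose_apply, finTwoArrowEquiv_symm_apply,
    Matrix.cons_val_zero, Matrix.cons_val_one, Matrix.one_apply, funext_iff, Fin.forall_fin_two]
  have := hU' (x 1) (y 1)
  rcases hx : x 0 <;> rcases hy : y 0 <;> rcases hx1 : x 1 <;> rcases hy1 : y 1 <;>
    simp_all

theorem oracleMatrix_isometry {k l : ℕ} (f : BoolFun k l) :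
    (oracleMatrix f).conjTranspose * oracleMatrix f = 1 := by
  ext x y
  rw [Matrix.mul_apply]
  simp only [oracleMatrix, Matrix.conjTranspose_apply, apply_ite star, star_one, star_zero,
    mul_ite, mul_one, mul_zero]
  rw [Finset.sum_ite_eq' Finset.univ]
  simp only [Finset.mem_univ, if_true, Matrix.one_apply]
  congr 1
  rw [eq_iff_iff]
  constructor
  · intro h
    have h1 : ∀ i, y (Sum.inl i) = x (Sum.inl i) := fun i => congrFun h (Sum.inl i)
    funext j
    rcases j with i | j
    · exact (h1 i).symm
    · have h2 := congrFun h (Sum.inr j)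
      simp only [Sum.elim_inr, h1] at h2
      exact (Bool.xor_left_inj.1 h2).symm
  · rintro rfl
    rfl

/-! ### Circuits as positive trace-preserving linear maps -/

section Act

variable {n m w : ℕ}

/-- The projector onto the basis states with bit `x` on wire `i`. -/
def wireProj (i : Fin w) (x : Bool) : QOp w := Matrix.diagonal fun b => if b i = x then 1 else 0

theorem Gate.act_meas_eq (G : BoolFun n m) (H : BoolFun m n) (i : Fin w) (ρ : QOp w) :
    (Gate.meas i).act G H ρ = wireProj i true * ρ * (wireProj i true).conjTranspose +
      wireProj i false * ρ * (wireProj i false).conjTranspose := by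
  ext b c
  simp only [Gate.act, wireProj, Matrix.diagonal_conjTranspose, Matrix.add_apply,
    Matrix.mul_diagonal, Matrix.diagonal_mul, Pi.star_apply]
  cases b i <;> cases c i <;> simp

/-- Every gate other than a measurement acts by conjugation with an isometry. -/
theorem Gate.act_eq_conj_or_meas (G : BoolFun n m) (H : BoolFun m n) (g : Gate n m w) :
    (∃ U : QOp w, U.conjTranspose * U = 1 ∧ ∀ ρ, g.act G H ρ = U * ρ * U.conjTranspose) ∨
      ∃ i, g = .meas i := by
  have lift : ∀ U : Matrix Bool Bool ℂ, U.conjTranspose * U = 1 → ∀ i : Fin w,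
      (onWire i U).conjTranspose * onWire i U = 1 := fun U hU i => by
    refine onWires_isometry _ ?_
    change (U.submatrix (Equiv.funUnique Unit Bool) (Equiv.funUnique Unit Bool)).conjTranspose *
      U.submatrix (Equiv.funUnique Unit Bool) (Equiv.funUnique Unit Bool) = 1
    rw [Matrix.conjTranspose_submatrix, Matrix.submatrix_mul_equiv, hU, Matrix.submatrix_one_equiv]
  cases g with
  | had i => exact .inl ⟨_, lift _ hadamard_isometry i, fun _ => rfl⟩
  | tgate i => exact .inl ⟨_, lift _ tMatrix_isometry i, fun _ => rfl⟩
  | cnot e => exact .inl ⟨_, onWires_isometry _ (controlled_isometry notMatrix_isometry), fun _ => rfl⟩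
  | chad e => exact .inl ⟨_, onWires_isometry _ (controlled_isometry hadamard_isometry), fun _ => rfl⟩
  | meas i => exact .inr ⟨i, rfl⟩
  | queryG e => exact .inl ⟨_, onWires_isometry _ (oracleMatrix_isometry G), fun _ => rfl⟩
  | queryH e => exact .inl ⟨_, onWires_isometry _ (oracleMatrix_isometry H), fun _ => rfl⟩

theorem trace_conj {U : QOp w} (hU : U.conjTranspose * U = 1) (ρ : QOp w) :
    (U * ρ * U.conjTranspose).trace = ρ.trace := by
  rw [Matrix.trace_mul_comm, ← mul_assoc, hU, one_mul]

/-- The action of a gate as a linear map. -/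
noncomputable def Gate.actLin (G : BoolFun n m) (H : BoolFun m n) (g : Gate n m w) :
    QOp w →ₗ[ℂ] QOp w where
  toFun := g.act G H
  map_add' ρ σ := by
    rcases g.act_eq_conj_or_meas G H with ⟨U, -, h⟩ | ⟨i, rfl⟩
    · simp only [h, mul_add, add_mul]
    · simp only [Gate.act_meas_eq, mul_add, add_mul]; abel
  map_smul' c ρ := by
    rcases g.act_eq_conj_or_meas G H with ⟨U, -, h⟩ | ⟨i, rfl⟩
    · simp [h]
    · simp [Gate.act_meas_eq]

theorem Gate.act_posSemidef (G : BoolFun n m) (H : BoolFun m n) (g : Gate n m w) {ρ : QOp w}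
    (hρ : ρ.PosSemidef) : (g.act G H ρ).PosSemidef := by
  rcases g.act_eq_conj_or_meas G H with ⟨U, -, h⟩ | ⟨i, rfl⟩
  · rw [h]; exact hρ.mul_mul_conjTranspose_same U
  · rw [Gate.act_meas_eq]
    exact (hρ.mul_mul_conjTranspose_same _).add (hρ.mul_mul_conjTranspose_same _)

theorem Gate.trace_act (G : BoolFun n m) (H : BoolFun m n) (g : Gate n m w) (ρ : QOp w) :
    (g.act G H ρ).trace = ρ.trace := by
  rcases g.act_eq_conj_or_meas G H with ⟨U, hU, h⟩ | ⟨i, rfl⟩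
  · rw [h, trace_conj hU]
  · simp [Matrix.trace, Gate.act, Matrix.diag]

/-- The joint action of a list of gates. -/
noncomputable def gatesLin (G : BoolFun n m) (H : BoolFun m n) : List (Gate n m w) →
    QOp w →ₗ[ℂ] QOp w
  | [] => .id
  | g :: gs => gatesLin G H gs ∘ₗ g.actLin G H

theorem foldl_act_eq_gatesLin (G : BoolFun n m) (H : BoolFun m n) (gs : List (Gate n m w))
    (ρ : QOp w) : gs.foldl (fun σ g => g.act G H σ) ρ = gatesLin G H gs ρ := by
  induction gs generalizing ρ with
  | nil => rfl
  | cons g gs ih => exact ih _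

theorem gatesLin_posSemidef (G : BoolFun n m) (H : BoolFun m n) (gs : List (Gate n m w))
    {ρ : QOp w} (hρ : ρ.PosSemidef) : (gatesLin G H gs ρ).PosSemidef := by
  induction gs generalizing ρ with
  | nil => exact hρ
  | cons g gs ih => exact ih (g.act_posSemidef G H hρ)

theorem trace_gatesLin (G : BoolFun n m) (H : BoolFun m n) (gs : List (Gate n m w))
    (ρ : QOp w) : (gatesLin G H gs ρ).trace = ρ.trace := by
  induction gs generalizing ρ with
  | nil => rfl
  | cons g gs ih => exact (ih _).trans (g.trace_act G H ρ)

end Act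

/-! ### The hybrid argument -/

section Hybrid

variable {n m w k : ℕ}

/-- A linear functional that is bounded by `0` and the trace on positive operators: the probability of
some outcome of a measurement. -/
def IsEffect (φ : QOp k →ₗ[ℂ] ℂ) : Prop :=
  ∀ ρ : QOp k, ρ.PosSemidef → 0 ≤ (φ ρ).re ∧ (φ ρ).re ≤ ρ.trace.re

theorem IsEffect.comp_gatesLin {φ : QOp w →ₗ[ℂ] ℂ} (hφ : IsEffect φ) (G : BoolFun n m)
    (H : BoolFun m n) (gs : List (Gate n m w)) : IsEffect (φ ∘ₗ gatesLin G H gs) := fun ρ hρ => by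
  have := hφ _ (gatesLin_posSemidef G H gs hρ)
  rwa [trace_gatesLin] at this

/-- The parallelogram-type inequality `(B + D) ρ (B + D)ᴴ ≤ (1 + s²) B ρ Bᴴ + (1 + s⁻²) D ρ Dᴴ`, tested
against an effect. It replaces the Cauchy–Schwarz inequality for the trace norm. -/
theorem IsEffect.conj_add_le {φ : QOp w →ₗ[ℂ] ℂ} (hφ : IsEffect φ) {ρ : QOp w}
    (hρ : ρ.PosSemidef) (B D : QOp w) {s : ℝ} (hs : s ≠ 0) :
    (φ ((B + D) * ρ * (B + D).conjTranspose)).re ≤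
      (1 + s ^ 2) * (φ (B * ρ * B.conjTranspose)).re +
        (1 + (s ^ 2)⁻¹) * (φ (D * ρ * D.conjTranspose)).re := by
  have hs' : (s : ℂ) ≠ 0 := by exact_mod_cast hs
  have key : ((1 + s ^ 2 : ℝ) : ℂ) • (B * ρ * B.conjTranspose) +
      ((1 + (s ^ 2)⁻¹ : ℝ) : ℂ) • (D * ρ * D.conjTranspose) -
      (B + D) * ρ * (B + D).conjTranspose =
      ((s : ℂ) • B - (s : ℂ)⁻¹ • D) * ρ * ((s : ℂ) • B - (s : ℂ)⁻¹ • D).conjTranspose := by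
    simp only [Matrix.conjTranspose_sub, Matrix.conjTranspose_smul, Matrix.conjTranspose_add,
      sub_mul, mul_sub, add_mul, mul_add, smul_mul_assoc, mul_smul_comm, Complex.star_def,
      map_inv₀, Complex.conj_ofReal, smul_sub, smul_smul, mul_inv_cancel₀ hs', inv_mul_cancel₀ hs']
    push_cast
    module
  have h0 := (hφ _ (hρ.mul_mul_conjTranspose_same ((s : ℂ) • B - (s : ℂ)⁻¹ • D))).1
  rw [← key] at h0
  simp only [map_sub, map_add, map_smul, smul_eq_mul, Complex.sub_re, Complex.add_re,
    Complex.re_ofReal_mul] at h0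
  linarith

/-- A possible oracle input: a point of the domain of `G` or of `H`. -/
abbrev OraclePoint (n m : ℕ) := (Fin n → Bool) ⊕ (Fin m → Bool)

/-- The point on which a gate queries an oracle when the register is in the basis state `b`. -/
def Gate.queried : Gate n m w → (Fin w → Bool) → Option (OraclePoint n m)
  | .queryG e, b => some (.inl fun i => b (e (.inl i)))
  | .queryH e, b => some (.inr fun i => b (e (.inl i)))
  | _, _ => none

/-- The two pairs of oracles agree outside of `S`. -/
def AgreeOff (S : Finset (OraclePoint n m)) (G G' : BoolFun n m) (H H' : BoolFun m n) : Prop :=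
  (∀ y, .inl y ∉ S → G' y = G y) ∧ ∀ v, .inr v ∉ S → H' v = H v

theorem onWires_oracleMatrix_congr {k l : ℕ} (e : Fin k ⊕ Fin l ↪ Fin w) {f f' : BoolFun k l}
    (b c : Fin w → Bool) (h : f' (fun i => c (e (.inl i))) = f (fun i => c (e (.inl i)))) :
    onWires e (oracleMatrix f') b c = onWires e (oracleMatrix f) b c := by
  simp only [onWires, oracleMatrix, h]

/-- Either a gate acts in the same way for both pairs of oracles, or it acts by conjugation with isometries
whose columns agree wherever the query avoids `S`. -/
theorem Gate.act_eq_conj_pair {S : Finset (OraclePoint n m)} {G G' : BoolFun n m}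
    {H H' : BoolFun m n} (hS : AgreeOff S G G' H H') (g : Gate n m w) :
    (∃ U U' : QOp w, U.conjTranspose * U = 1 ∧ U'.conjTranspose * U' = 1 ∧
      (∀ ρ, g.act G H ρ = U * ρ * U.conjTranspose) ∧
      (∀ ρ, g.act G' H' ρ = U' * ρ * U'.conjTranspose) ∧
      ∀ b c, (∀ p ∈ S, g.queried c ≠ some p) → U' b c = U b c) ∨
    ∀ ρ, g.act G' H' ρ = g.act G H ρ := by
  cases g with
  | queryG e =>
    exact .inl ⟨_, _, onWires_isometry _ (oracleMatrix_isometry G),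
      onWires_isometry _ (oracleMatrix_isometry G'), fun _ => rfl, fun _ => rfl, fun b c h =>
        onWires_oracleMatrix_congr _ _ _ (hS.1 _ fun hm => h _ hm rfl)⟩
  | queryH e =>
    exact .inl ⟨_, _, onWires_isometry _ (oracleMatrix_isometry H),
      onWires_isometry _ (oracleMatrix_isometry H'), fun _ => rfl, fun _ => rfl, fun b c h =>
        onWires_oracleMatrix_congr _ _ _ (hS.2 _ fun hm => h _ hm rfl)⟩
  | _ => exact .inr fun _ => rfl

/-- The probability that measuring the query register of `g` in the state `ρ` yields the point `p`. -/
def Gate.pointWeight (g : Gate n m w) (p : OraclePoint n m) : QOp w →ₗ[ℂ] ℂ where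
  toFun ρ := ∑ b, if g.queried b = some p then ρ b b else 0
  map_add' ρ σ := by
    rw [← Finset.sum_add_distrib]
    exact Finset.sum_congr rfl fun b _ => by split_ifs <;> simp
  map_smul' c ρ := by
    simp [Finset.mul_sum]

theorem posSemidef_diag_re_nonneg {ρ : QOp w} (hρ : ρ.PosSemidef) (b : Fin w → Bool) :
    0 ≤ (ρ b b).re := (Complex.nonneg_iff.1 (hρ.diag_nonneg (i := b))).1

theorem Gate.pointWeight_re (g : Gate n m w) (p : OraclePoint n m) (ρ : QOp w) :
    (g.pointWeight p ρ).re = ∑ b, if g.queried b = some p then (ρ b b).re else 0 := by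
  simp [Gate.pointWeight, Complex.re_sum, apply_ite Complex.re]

theorem Gate.pointWeight_nonneg (g : Gate n m w) (p : OraclePoint n m) {ρ : QOp w}
    (hρ : ρ.PosSemidef) : 0 ≤ (g.pointWeight p ρ).re := by
  rw [Gate.pointWeight_re]
  exact Finset.sum_nonneg fun b _ => by
    split_ifs
    exacts [posSemidef_diag_re_nonneg hρ b, le_rfl]

theorem Gate.sum_pointWeight_le (g : Gate n m w) (S : Finset (OraclePoint n m)) {ρ : QOp w}
    (hρ : ρ.PosSemidef) : ∑ p ∈ S, (g.pointWeight p ρ).re ≤ ρ.trace.re := by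
  simp only [Gate.pointWeight_re, Matrix.trace, Matrix.diag, Complex.re_sum]
  rw [Finset.sum_comm]
  refine Finset.sum_le_sum fun b _ => ?_
  rcases h : g.queried b with _ | p
  · simpa using posSemidef_diag_re_nonneg hρ b
  · simp only [Option.some.injEq]
    rw [Finset.sum_ite_eq]
    split_ifs
    exacts [le_rfl, posSemidef_diag_re_nonneg hρ b]

/-- The expected number of queries on the point `p` during the execution of a list of gates, if the
query registers are measured before each query separately. -/
noncomputable def queryWeight (G : BoolFun n m) (H : BoolFun m n) (p : OraclePoint n m) :
    List (Gate n m w) → QOp w →ₗ[ℂ] ℂ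
  | [] => 0
  | g :: gs => g.pointWeight p + queryWeight G H p gs ∘ₗ g.actLin G H

theorem queryWeight_nonneg (G : BoolFun n m) (H : BoolFun m n) (p : OraclePoint n m)
    (gs : List (Gate n m w)) {ρ : QOp w} (hρ : ρ.PosSemidef) :
    0 ≤ (queryWeight G H p gs ρ).re := by
  induction gs generalizing ρ with
  | nil => simp [queryWeight]
  | cons g gs ih => exact add_nonneg (g.pointWeight_nonneg p hρ) (ih (g.act_posSemidef G H hρ))

theorem sum_queryWeight_le (G : BoolFun n m) (H : BoolFun m n) (S : Finset (OraclePoint n m))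
    (gs : List (Gate n m w)) {ρ : QOp w} (hρ : ρ.PosSemidef) :
    ∑ p ∈ S, (queryWeight G H p gs ρ).re ≤ gs.length * ρ.trace.re := by
  induction gs generalizing ρ with
  | nil => simp [queryWeight]
  | cons g gs ih =>
    have h1 := g.sum_pointWeight_le S hρ
    have h2 := ih (g.act_posSemidef G H hρ)
    rw [g.trace_act] at h2
    have h3 : ∀ p, (queryWeight G H p (g :: gs) ρ).re =
      (g.pointWeight p ρ).re + (queryWeight G H p gs (g.act G H ρ)).re := fun p => rfl
    simp only [h3, Finset.sum_add_distrib, List.length_cons]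
    push_cast
    linarith

/-- Two isometries that agree on all columns outside `bad` have almost the same effect on states with
little weight on `bad`. The parameter `s` trades the additive error for the factor in front of that
weight. -/
theorem IsEffect.conj_sub_le {φ : QOp w →ₗ[ℂ] ℂ} (hφ : IsEffect φ) {ρ : QOp w}
    (hρ : ρ.PosSemidef) {U U' : QOp w} (hU : U.conjTranspose * U = 1)
    (hU' : U'.conjTranspose * U' = 1) (bad : (Fin w → Bool) → Prop) [DecidablePred bad]
    (h : ∀ b c, ¬ bad c → U' b c = U b c) {s : ℝ} (hs : s ≠ 0) :
    (φ (U' * ρ * U'.conjTranspose)).re - (φ (U * ρ * U.conjTranspose)).re ≤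
      s ^ 2 * ρ.trace.re +
        4 * (1 + (s ^ 2)⁻¹) * ∑ b, if bad b then (ρ b b).re else 0 := by
  set Q : QOp w := Matrix.diagonal fun b => if bad b then 1 else 0 with hQ
  have hD : U' - U = U' * Q + -(U * Q) := by
    ext b c
    simp only [Matrix.sub_apply, Matrix.add_apply, Matrix.neg_apply, hQ, Matrix.mul_diagonal]
    by_cases hc : bad c
    · simp [hc, sub_eq_add_neg]
    · simp [hc, h b c hc]
  have htr : ((Q * ρ * Q.conjTranspose).trace).re = ∑ b, if bad b then (ρ b b).re else 0 := by
    simp only [Matrix.trace, Matrix.diag, hQ, Matrix.diagonal_conjTranspose, Matrix.mul_diagonal,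
      Matrix.diagonal_mul, Complex.re_sum]
    exact Finset.sum_congr rfl fun b _ => by by_cases hb : bad b <;> simp [hb]
  have hQρ := hρ.mul_mul_conjTranspose_same Q
  have conj : ∀ V : QOp w, V.conjTranspose * V = 1 →
      (φ (V * Q * ρ * (V * Q).conjTranspose)).re ≤ ∑ b, if bad b then (ρ b b).re else 0 := by
    intro V hV
    have e : V * Q * ρ * (V * Q).conjTranspose = V * (Q * ρ * Q.conjTranspose) * V.conjTranspose := by
      rw [Matrix.conjTranspose_mul]; simp only [mul_assoc]
    have := (hφ _ (hQρ.mul_mul_conjTranspose_same V)).2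
    rwa [trace_conj hV, htr, ← e] at this
  have h1 := hφ.conj_add_le hρ U (U' - U) hs
  have h2 := hφ.conj_add_le hρ (U' * Q) (-(U * Q)) one_ne_zero
  rw [← hD, Matrix.conjTranspose_neg, neg_mul, neg_mul_neg] at h2
  rw [add_sub_cancel] at h1
  have h3 := conj U hU
  have h4 := conj U' hU'
  have h5 := (hφ _ (hρ.mul_mul_conjTranspose_same U)).2
  rw [trace_conj hU] at h5
  have h6 : (φ ((U' - U) * ρ * (U' - U).conjTranspose)).re ≤
      4 * ∑ b, if bad b then (ρ b b).re else 0 := by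
    rw [one_pow, inv_one, one_add_one_eq_two] at h2
    linarith
  have h7 := mul_le_mul_of_nonneg_left h6 (show 0 ≤ 1 + (s ^ 2)⁻¹ by positivity)
  have h8 := mul_le_mul_of_nonneg_left h5 (sq_nonneg s)
  linarith

theorem Gate.abs_act_sub_le {S : Finset (OraclePoint n m)} {G G' : BoolFun n m}
    {H H' : BoolFun m n} (hS : AgreeOff S G G' H H') (g : Gate n m w) {φ : QOp w →ₗ[ℂ] ℂ}
    (hφ : IsEffect φ) {ρ : QOp w} (hρ : ρ.PosSemidef) {s : ℝ} (hs : s ≠ 0) :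
    |(φ (g.act G' H' ρ)).re - (φ (g.act G H ρ)).re| ≤
      s ^ 2 * ρ.trace.re + 4 * (1 + (s ^ 2)⁻¹) * ∑ p ∈ S, (g.pointWeight p ρ).re := by
  have hw : 0 ≤ ∑ p ∈ S, (g.pointWeight p ρ).re :=
    Finset.sum_nonneg fun p _ => g.pointWeight_nonneg p hρ
  have htr : 0 ≤ ρ.trace.re := (Complex.nonneg_iff.1 hρ.trace_nonneg).1
  rcases g.act_eq_conj_pair hS with ⟨U, U', hU, hU', e, e', h⟩ | h
  · classical
    have hbad : (∑ b, if ∃ p ∈ S, g.queried b = some p then (ρ b b).re else 0) =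
        ∑ p ∈ S, (g.pointWeight p ρ).re := by
      simp only [Gate.pointWeight_re]
      rw [Finset.sum_comm]
      refine Finset.sum_congr rfl fun b _ => ?_
      rcases g.queried b with _ | p
      · simp
      · simp only [Option.some.injEq, Finset.sum_ite_eq, exists_eq_right']
    rw [e, e', ← hbad, abs_sub_le_iff]
    refine ⟨hφ.conj_sub_le hρ hU hU' _ (fun b c hc => h b c ?_) hs,
      hφ.conj_sub_le hρ hU' hU _ (fun b c hc => (h b c ?_).symm) hs⟩ <;>
    exact fun p hp hq => hc ⟨p, hp, hq⟩
  · rw [h, sub_self, abs_zero]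
    positivity

/-- Reprogramming the oracles on the points of `S` hardly changes the outcome of a computation that
hardly queries these points. -/
theorem abs_gatesLin_sub_le {S : Finset (OraclePoint n m)} {G G' : BoolFun n m}
    {H H' : BoolFun m n} (hS : AgreeOff S G G' H H') (gs : List (Gate n m w)) {φ : QOp w →ₗ[ℂ] ℂ}
    (hφ : IsEffect φ) {ρ : QOp w} (hρ : ρ.PosSemidef) {s : ℝ} (hs : s ≠ 0) :
    |(φ (gatesLin G' H' gs ρ)).re - (φ (gatesLin G H gs ρ)).re| ≤
      gs.length * s ^ 2 * ρ.trace.re +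
        4 * (1 + (s ^ 2)⁻¹) * ∑ p ∈ S, (queryWeight G H p gs ρ).re := by
  induction gs generalizing ρ with
  | nil => simp [gatesLin, queryWeight]
  | cons g gs ih =>
    have h1 := g.abs_act_sub_le hS (hφ.comp_gatesLin G' H' gs) hρ hs
    have h2 := ih (g.act_posSemidef G H hρ)
    rw [g.trace_act] at h2
    have h3 : ∀ p, (queryWeight G H p (g :: gs) ρ).re =
      (g.pointWeight p ρ).re + (queryWeight G H p gs (g.act G H ρ)).re := fun p => rfl
    have h4 := abs_sub_le (φ (gatesLin G' H' gs (g.act G' H' ρ))).re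
      (φ (gatesLin G' H' gs (g.act G H ρ))).re (φ (gatesLin G H gs (g.act G H ρ))).re
    simp only [h3, Finset.sum_add_distrib, List.length_cons, mul_add]
    push_cast
    simp only [LinearMap.comp_apply] at h1
    change |(φ (gatesLin G' H' gs (g.act G' H' ρ))).re - (φ (gatesLin G H gs (g.act G H ρ))).re| ≤ _
    linarith

end Hybrid

/-! ### Tensor products and BB84 states -/

section Tensor

variable {k l : ℕ}

open scoped Kronecker in
theorem tens_eq_submatrix (ρ : QOp k) (σ : QOp l) :
    tens ρ σ = (ρ ⊗ₖ σ).submatrix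
      (fun b => (fun i => b (Fin.castAdd l i), fun j => b (Fin.natAdd k j)))
      (fun b => (fun i => b (Fin.castAdd l i), fun j => b (Fin.natAdd k j))) := rfl

theorem tens_posSemidef {ρ : QOp k} {σ : QOp l} (hρ : ρ.PosSemidef) (hσ : σ.PosSemidef) :
    (tens ρ σ).PosSemidef := by
  rw [tens_eq_submatrix]
  exact (hρ.kronecker hσ).submatrix _

/-- Tensoring with a fixed operator on the right, as a linear map. -/
noncomputable def tensRight (σ : QOp l) : QOp k →ₗ[ℂ] QOp (k + l) where
  toFun ρ := tens ρ σ
  map_add' ρ ρ' := by ext b c; simp [tens, add_mul]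
  map_smul' a ρ := by ext b c; simp [tens, mul_assoc]

/-- Tensoring with a fixed operator on the left, as a linear map. -/
noncomputable def tensLeft (ρ : QOp k) : QOp l →ₗ[ℂ] QOp (k + l) where
  toFun σ := tens ρ σ
  map_add' ρ ρ' := by ext b c; simp [tens, mul_add]
  map_smul' a ρ := by ext b c; simp [tens, mul_left_comm]

theorem tens_one_one : tens (1 : QOp k) (1 : QOp l) = 1 := by
  rw [tens_eq_submatrix, Matrix.one_kronecker_one]
  refine Matrix.submatrix_one _ fun b c h => ?_
  funext i
  refine Fin.addCases (fun i => ?_) (fun j => ?_) i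
  · exact congrFun (Prod.ext_iff.1 h).1 i
  · exact congrFun (Prod.ext_iff.1 h).2 j

theorem trace_tens (ρ : QOp k) (σ : QOp l) : (tens ρ σ).trace = ρ.trace * σ.trace := by
  simp only [Matrix.trace, Matrix.diag, tens]
  rw [Finset.sum_mul_sum, ← Fintype.sum_prod_type']
  exact Fintype.sum_equiv (Fin.appendEquiv k l (α := Bool)).symm _ _ fun b => rfl

theorem ketbra_posSemidef (ψ : (Fin k → Bool) → ℂ) : (ketbra ψ).PosSemidef :=
  Matrix.posSemidef_vecMulVec_self_star ψ

theorem ketbra_ket_apply (x b c : Fin k → Bool) :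
    ketbra (ket x) b c = if b = x ∧ c = x then 1 else 0 := by
  simp only [ketbra, ket, Matrix.vecMulVec_apply, Pi.star_apply, Pi.single_apply]
  by_cases hb : b = x <;> by_cases hc : c = x <;> simp [hb, hc]

theorem sum_ketbra_ket : ∑ x : Fin k → Bool, ketbra (ket x) = 1 := by
  ext b c
  rw [Matrix.sum_apply]
  simp only [ketbra_ket_apply, Matrix.one_apply]
  by_cases h : b = c
  · subst h; simp
  · rw [if_neg h]
    exact Finset.sum_eq_zero fun x _ => if_neg fun hx => h (hx.1.trans hx.2.symm)

theorem trace_ketbra_ket (x : Fin k → Bool) : (ketbra (ket x)).trace = 1 := by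
  simp [Matrix.trace, Matrix.diag, ketbra_ket_apply]

end Tensor

section ProdOp

variable {k : ℕ}

/-- The tensor product of one-qubit operators. -/
def prodOp (A : Fin k → Matrix Bool Bool ℂ) : QOp k := fun x y => ∏ i, A i (x i) (y i)

open scoped Kronecker in
theorem prodOp_succ (A : Fin (k + 1) → Matrix Bool Bool ℂ) :
    prodOp A = (A 0 ⊗ₖ prodOp fun i => A i.succ).submatrix
      (fun b => (b 0, fun i => b i.succ)) (fun b => (b 0, fun i => b i.succ)) := by
  ext b c
  simp [prodOp, Fin.prod_univ_succ]

/-- The operator norm of a tensor product of positive operators is at most the product of the norms: from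
`A ≤ r` and `B ≤ s` follows `A ⊗ B ≤ r s`, because `r s - A ⊗ B = (r - A) ⊗ s + A ⊗ (s - B)`. -/
theorem pow_smul_one_sub_prodOp_posSemidef {r : ℝ} (hr : 0 ≤ r) {A : Fin k → Matrix Bool Bool ℂ}
    (hA : ∀ i, (A i).PosSemidef) (hr' : ∀ i, ((r : ℂ) • (1 : Matrix Bool Bool ℂ) - A i).PosSemidef) :
    ((r : ℂ) ^ k • (1 : QOp k) - prodOp A).PosSemidef := by
  induction k with
  | zero =>
    have : (r : ℂ) ^ 0 • (1 : QOp 0) - prodOp A = 0 := by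
      ext b c
      simp [prodOp, Subsingleton.elim b c]
    rw [this]
    exact Matrix.PosSemidef.zero
  | succ k ih =>
    have h1 : ((r : ℂ) ^ k • (1 : QOp k)).PosSemidef :=
      Matrix.PosSemidef.one.smul (by exact_mod_cast pow_nonneg hr k)
    have h2 := (((hr' 0).kronecker h1).add
      ((hA 0).kronecker (ih (fun i => hA i.succ) fun i => hr' i.succ))).submatrix
      (fun b : Fin (k + 1) → Bool => (b 0, fun i : Fin k => b i.succ))
    refine (congrArg Matrix.PosSemidef ?_).mpr h2
    ext b c
    have h3 : (1 : QOp (k + 1)) b c = (1 : Matrix Bool Bool ℂ) (b 0) (c 0) *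
        (1 : QOp k) (fun i => b i.succ) (fun i => c i.succ) := by
      simp only [Matrix.one_apply, funext_iff, Fin.forall_fin_succ]
      split_ifs <;> simp_all
    rw [prodOp_succ]
    simp only [Matrix.sub_apply, Matrix.smul_apply, Matrix.submatrix_apply, Matrix.add_apply,
      Matrix.kroneckerMap_apply, smul_eq_mul, h3]
    ring

theorem sum_prodOp (A : Fin k → Bool → Matrix Bool Bool ℂ) :
    ∑ t : Fin k → Bool, prodOp (fun i => A i (t i)) = prodOp fun i => ∑ b, A i b := by
  ext x y
  rw [Matrix.sum_apply]
  simp only [prodOp, Matrix.sum_apply]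
  rw [Finset.prod_univ_sum, Fintype.piFinset_univ]

theorem prodOp_one : prodOp (fun _ : Fin k => (1 : Matrix Bool Bool ℂ)) = 1 := by
  ext x y
  simp only [prodOp, Matrix.one_apply]
  rw [Finset.prod_ite_zero]
  simp [funext_iff]

end ProdOp

section BB84

/-- The one-qubit BB84 state `Had^θ |v⟩⟨v| Had^θ`. -/
noncomputable def bb84Qubit (θ v : Bool) : Matrix Bool Bool ℂ :=
  Matrix.vecMulVec (fun x => (if θ then hadamard else 1) x v)
    (star fun x => (if θ then hadamard else 1) x v)

theorem bb84_apply {k : ℕ} (v θ b : Fin k → Bool) :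
    bb84 v θ b = ∏ i, (if θ i then hadamard else 1) (b i) (v i) := by
  simp [bb84, ket, hadamardPow]

theorem ketbra_bb84 {k : ℕ} (v θ : Fin k → Bool) :
    ketbra (bb84 v θ) = prodOp fun i => bb84Qubit (θ i) (v i) := by
  ext b c
  simp only [ketbra, Matrix.vecMulVec_apply, Pi.star_apply, bb84_apply, prodOp, bb84Qubit,
    Finset.prod_mul_distrib, Complex.star_def, map_prod]

theorem hadamard_mul_conjTranspose : hadamard * hadamard.conjTranspose = 1 :=
  mul_eq_one_comm.1 hadamard_isometry

theorem sum_bb84Qubit (θ : Bool) : ∑ v, bb84Qubit θ v = 1 := by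
  have : ∑ v, bb84Qubit θ v = (if θ then hadamard else 1) *
      (if θ then hadamard else (1 : Matrix Bool Bool ℂ)).conjTranspose := by
    ext x y
    simp only [Matrix.sum_apply, bb84Qubit, Matrix.vecMulVec_apply, Pi.star_apply, Matrix.mul_apply,
      Matrix.conjTranspose_apply]
  rw [this]
  cases θ
  · simp
  · simpa using hadamard_mul_conjTranspose

theorem sum_ketbra_bb84 {k : ℕ} (θ : Fin k → Bool) : ∑ v, ketbra (bb84 v θ) = 1 := by
  simp only [ketbra_bb84]
  rw [sum_prodOp fun i => bb84Qubit (θ i)]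
  simp only [sum_bb84Qubit, prodOp_one]

theorem sum_bb84Qubit_basis_apply (v x y : Bool) :
    (∑ θ, bb84Qubit θ v) x y =
      (if (x && v) = (y && v) then 1 / 2 else -1 / 2) + if x = v ∧ y = v then 1 else 0 := by
  have h := inv_sqrt_two_mul_self
  have h' : (starRingEnd ℂ) ((Real.sqrt 2 : ℝ) : ℂ)⁻¹ = ((Real.sqrt 2 : ℝ) : ℂ)⁻¹ := by
    rw [map_inv₀, Complex.conj_ofReal]
  rw [Matrix.sum_apply, Fintype.sum_bool]
  simp only [bb84Qubit, Matrix.vecMulVec_apply, Pi.star_apply, if_true, Bool.false_eq_true,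
    if_false, hadamard]
  generalize ((Real.sqrt 2 : ℝ) : ℂ)⁻¹ = r at h h'
  cases v <;> cases x <;> cases y <;> simp [h, h'] <;> norm_num

/-- A qubit in a BB84 state for a uniformly random basis has largest eigenvalue
`(1 + 1 / √2) / 2 = cos² (π / 8)`. -/
theorem smul_one_sub_sum_bb84Qubit_posSemidef (v : Bool) :
    (((1 + (√2)⁻¹ : ℝ) : ℂ) • (1 : Matrix Bool Bool ℂ) - ∑ θ, bb84Qubit θ v).PosSemidef := by
  set r : ℝ := (√2)⁻¹ with hr
  have hr2 : r * r = 1 / 2 := by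
    rw [hr, ← mul_inv, Real.mul_self_sqrt (by norm_num)]; norm_num
  have hr0 : 0 < r := by positivity
  have hr1 : 0 < r - 1 / 2 := by nlinarith
  have hrc : (r : ℂ) * r = 1 / 2 := by simpa using congrArg Complex.ofReal hr2
  have hrc1 : (r : ℂ) - 1 / 2 ≠ 0 := by
    have : ((r - 1 / 2 : ℝ) : ℂ) ≠ 0 := by exact_mod_cast hr1.ne'
    simpa using this
  -- The operator has determinant zero; this vector spans its range.
  let u : Bool → ℂ := fun x => if x = v then ((r - 1 / 2 : ℝ) : ℂ) else if v then 1 / 2 else -1 / 2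
  have key : ((1 + r : ℝ) : ℂ) • (1 : Matrix Bool Bool ℂ) - ∑ θ, bb84Qubit θ v =
      (((r - 1 / 2)⁻¹ : ℝ) : ℂ) • Matrix.vecMulVec u (star u) := by
    ext x y
    rw [Matrix.sub_apply, Matrix.smul_apply, sum_bb84Qubit_basis_apply, Matrix.smul_apply,
      Matrix.vecMulVec_apply, Pi.star_apply]
    simp only [smul_eq_mul, u]
    push_cast
    rw [eq_inv_mul_iff_mul_eq₀ hrc1]
    cases v <;> cases x <;> cases y <;> simp [Complex.conj_ofReal, -mul_eq_mul_left_iff] <;>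
      first | linear_combination hrc | ring
  rw [key]
  exact (Matrix.posSemidef_vecMulVec_self_star u).smul
    (by exact_mod_cast (inv_pos.2 hr1).le)

theorem smul_one_sub_sum_ketbra_bb84_posSemidef {k : ℕ} (v : Fin k → Bool) :
    (((1 + (√2)⁻¹ : ℝ) : ℂ) ^ k • (1 : QOp k) - ∑ θ, ketbra (bb84 v θ)).PosSemidef := by
  simp only [ketbra_bb84]
  rw [sum_prodOp fun i θ => bb84Qubit θ (v i)]
  refine pow_smul_one_sub_prodOp_posSemidef (by positivity) (fun i => ?_)
    fun i => smul_one_sub_sum_bb84Qubit_posSemidef (v i)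
  rw [Fintype.sum_bool]
  exact (Matrix.posSemidef_vecMulVec_self_star _).add (Matrix.posSemidef_vecMulVec_self_star _)

end BB84

/-! ### Acceptance probability and query weights of a distinguisher -/

section Circuit

variable {n m a q k w : ℕ}

theorem reduceTo_diag (e : Fin k ↪ Fin w) (ρ : QOp w) (x : Fin k → Bool) :
    reduceTo e ρ x x = ∑ b, if ∀ j, b (e j) = x j then ρ b b else 0 := by
  simp only [reduceTo]
  refine Finset.sum_congr rfl fun b _ => ?_
  rw [Finset.sum_eq_single b]
  · simp
  · rintro c - hc
    refine if_neg fun ⟨h1, h2, h3⟩ => hc ?_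
    funext i
    by_cases hi : i ∈ Set.range e
    · obtain ⟨j, rfl⟩ := hi
      rw [h1, h2]
    · exact (h3 i hi).symm
  · simp

/-- The probability that the wires selected by `e` are in the basis state `x`. -/
noncomputable def outcomeLin (e : Fin k ↪ Fin w) (x : Fin k → Bool) : QOp w →ₗ[ℂ] ℂ where
  toFun ρ := reduceTo e ρ x x
  map_add' ρ σ := by
    simp only [reduceTo_diag, ← Finset.sum_add_distrib]
    exact Finset.sum_congr rfl fun b _ => by split_ifs <;> simp
  map_smul' c ρ := by simp [reduceTo_diag, Finset.mul_sum]

theorem outcomeLin_isEffect (e : Fin k ↪ Fin w) (x : Fin k → Bool) : IsEffect (outcomeLin e x) := by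
  intro ρ hρ
  have h : (outcomeLin e x ρ).re = ∑ b, if ∀ j, b (e j) = x j then (ρ b b).re else 0 := by
    change (reduceTo e ρ x x).re = _
    simp [reduceTo_diag, Complex.re_sum, apply_ite Complex.re]
  rw [h, Matrix.trace, Complex.re_sum]
  constructor
  · exact Finset.sum_nonneg fun b _ => by
      split_ifs
      exacts [posSemidef_diag_re_nonneg hρ b, le_rfl]
  · exact Finset.sum_le_sum fun b _ => by
      split_ifs
      exacts [le_rfl, posSemidef_diag_re_nonneg hρ b]

/-- Appending the auxiliary state and the ancillas to the input of a circuit. -/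
noncomputable def Circuit.load (C : Circuit n m (a + q) 1) (ν : QOp q) :
    QOp a →ₗ[ℂ] QOp (a + q + C.anc) :=
  tensRight (ketbra (ket fun _ : Fin C.anc => false)) ∘ₗ tensRight ν

theorem Circuit.load_posSemidef (C : Circuit n m (a + q) 1) {ν : QOp q} (hν : IsQState ν)
    {ρ : QOp a} (hρ : ρ.PosSemidef) : (C.load ν ρ).PosSemidef :=
  tens_posSemidef (tens_posSemidef hρ hν.1) (ketbra_posSemidef _)

theorem Circuit.trace_load (C : Circuit n m (a + q) 1) {ν : QOp q} (hν : IsQState ν)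
    (ρ : QOp a) : (C.load ν ρ).trace = ρ.trace := by
  change (tens (tens ρ ν) _).trace = _
  rw [trace_tens, trace_tens, trace_ketbra_ket, hν.2, mul_one, mul_one]

/-- The acceptance probability of a circuit with auxiliary state `ν`, as a linear functional. -/
noncomputable def Circuit.accept (C : Circuit n m (a + q) 1) (ν : QOp q)
    (O : BoolFun n m × BoolFun m n) : QOp a →ₗ[ℂ] ℂ :=
  outcomeLin C.out (fun _ => true) ∘ₗ gatesLin O.1 O.2 C.gates ∘ₗ C.load ν

/-- The total weight of the queries of a circuit with auxiliary state `ν` on a point. -/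
noncomputable def Circuit.weight (C : Circuit n m (a + q) 1) (ν : QOp q)
    (O : BoolFun n m × BoolFun m n) (p : OraclePoint n m) : QOp a →ₗ[ℂ] ℂ :=
  queryWeight O.1 O.2 p C.gates ∘ₗ C.load ν

theorem Circuit.run_eq_accept (C : Circuit n m (a + q) 1) (ν : QOp q) (O : BoolFun n m × BoolFun m n)
    (ρ : QOp a) : C.run O.1 O.2 (tens ρ ν) (fun _ => true) (fun _ => true) = C.accept ν O ρ := by
  rw [Circuit.run, foldl_act_eq_gatesLin]
  rfl

variable (C : Circuit n m (a + q) 1) {ν : QOp q} (hν : IsQState ν) (O : BoolFun n m × BoolFun m n)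

include hν

theorem Circuit.accept_isEffect : IsEffect (C.accept ν O) := fun ρ hρ => by
  have := ((outcomeLin_isEffect C.out fun _ => true).comp_gatesLin O.1 O.2 C.gates) _
    (C.load_posSemidef hν hρ)
  rwa [C.trace_load hν] at this

theorem Circuit.weight_nonneg (p : OraclePoint n m) {ρ : QOp a} (hρ : ρ.PosSemidef) :
    0 ≤ (C.weight ν O p ρ).re :=
  queryWeight_nonneg _ _ _ _ (C.load_posSemidef hν hρ)

theorem Circuit.sum_weight_le (S : Finset (OraclePoint n m)) {ρ : QOp a} (hρ : ρ.PosSemidef) :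
    ∑ p ∈ S, (C.weight ν O p ρ).re ≤ C.gates.length * ρ.trace.re := by
  have := sum_queryWeight_le O.1 O.2 S C.gates (C.load_posSemidef hν hρ)
  rwa [C.trace_load hν] at this

theorem Circuit.sum_weight_comp_le {α : Type} [Fintype α] (f : α ↪ OraclePoint n m) {ρ : QOp a}
    (hρ : ρ.PosSemidef) :
    ∑ y, (C.weight ν O (f y) ρ).re ≤ C.gates.length * ρ.trace.re := by
  have := C.sum_weight_le hν O (Finset.univ.map f) hρ
  rwa [Finset.sum_map] at this

theorem Circuit.abs_accept_sub_le {O' : BoolFun n m × BoolFun m n} {S : Finset (OraclePoint n m)}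
    (hS : AgreeOff S O.1 O'.1 O.2 O'.2) {ρ : QOp a} (hρ : IsQState ρ) {s : ℝ} (hs : s ≠ 0) :
    |(C.accept ν O' ρ).re - (C.accept ν O ρ).re| ≤
      C.gates.length * s ^ 2 + 4 * (1 + (s ^ 2)⁻¹) * ∑ p ∈ S, (C.weight ν O p ρ).re := by
  have := abs_gatesLin_sub_le hS C.gates (outcomeLin_isEffect C.out fun _ => true)
    (C.load_posSemidef hν hρ.1) hs
  rwa [C.trace_load hν, hρ.2, Complex.one_re, mul_one] at this

end Circuit

/-! ### The state in the security game -/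

section Game

variable {n m q : ℕ}

/-- A marked input `y`, together with fresh values of `v`, of the basis `θ`, and of the hash value `z`. -/
abbrev Sample (n m : ℕ) := (Fin n → Bool) × (Fin m → Bool) × (Fin m → Bool) × (Fin n → Bool)

/-- The state `|v^θ⟩⟨v^θ| ⊗ |z⟩⟨z|`. -/
noncomputable def Sample.state (x : Sample n m) : QOp (m + n) :=
  tens (ketbra (bb84 x.2.1 x.2.2.1)) (ketbra (ket x.2.2.2))

/-- The sample whose basis and hash value are the answers of the oracles. -/
def readSample (O : BoolFun n m × BoolFun m n) (y : Fin n → Bool) (v : Fin m → Bool) : Sample n m :=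
  (y, v, O.1 y, O.2 v)

/-- The oracles reprogrammed to give the answers recorded in a sample. -/
def reprogram (O : BoolFun n m × BoolFun m n) (x : Sample n m) : BoolFun n m × BoolFun m n :=
  (Function.update O.1 x.1 x.2.2.1, Function.update O.2 x.2.1 x.2.2.2)

/-- The probability of a sample, if `y` has distribution `d` and all else is uniform. -/
noncomputable def sampleProb (d : (Fin n → Bool) → ℝ) (x : Sample n m) : ℝ :=
  d x.1 * ((2 ^ m)⁻¹ * ((2 ^ m)⁻¹ * (2 ^ n)⁻¹))

theorem expect_bits {k : ℕ} (f : (Fin k → Bool) → ℝ) : 𝔼 x, f x = (2 ^ k)⁻¹ * ∑ x, f x := by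
  rw [Finset.expect_eq_sum_div_card, div_eq_inv_mul]
  simp

theorem sum_sampleProb_mul (d : (Fin n → Bool) → ℝ) (f : Sample n m → ℝ) :
    ∑ x, sampleProb d x * f x = ∑ y, d y * 𝔼 v, 𝔼 θ, 𝔼 z, f (y, v, θ, z) := by
  simp only [Fintype.sum_prod_type, sampleProb, expect_bits, Finset.mul_sum]
  refine Finset.sum_congr rfl fun y _ => Finset.sum_congr rfl fun v _ =>
    Finset.sum_congr rfl fun θ _ => Finset.sum_congr rfl fun z _ => ?_
  ring

theorem expect_prod {α β : Type} [Fintype α] [Fintype β] (f : α × β → ℝ) :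
    𝔼 p, f p = 𝔼 a, 𝔼 b, f (a, b) := by
  rw [← Finset.univ_product_univ]
  exact Finset.expect_product' _ _ fun a b => f (a, b)

/-- Resampling the value of a random function at a point. -/
theorem expect_update {α β : Type} [Fintype α] [DecidableEq α] [Fintype β] [Nonempty β] (y : α)
    (f : (α → β) → β → ℝ) :
    𝔼 G : α → β, f G (G y) = 𝔼 G : α → β, 𝔼 θ, f (Function.update G y θ) θ := by
  let e : (α → β) × β ≃ (α → β) × β := Function.Involutive.toPerm
    (fun p => (Function.update p.1 y p.2, p.1 y)) fun p => by simp
  have h := Fintype.expect_equiv e (fun p => f (Function.update p.1 y p.2) p.2)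
    (fun p => f p.1 (p.1 y)) fun p => by
      change _ = f (Function.update p.1 y p.2) (Function.update p.1 y p.2 y)
      rw [Function.update_self]
  rw [expect_prod, expect_prod] at h
  rw [h]
  exact Finset.expect_congr rfl fun G _ => (Finset.expect_const Finset.univ_nonempty _).symm

/-- Lazy sampling: instead of reading the answers of random oracles, one may sample the answers and
reprogram the oracles accordingly. -/
theorem expect_readSample (d : (Fin n → Bool) → ℝ)
    (F : BoolFun n m × BoolFun m n → Sample n m → ℝ) :
    𝔼 O, ∑ y, d y * 𝔼 v, F O (readSample O y v) =
      𝔼 O, ∑ x, sampleProb d x * F (reprogram O x) x := by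
  have key : ∀ y v, 𝔼 O, F O (readSample O y v) =
      𝔼 O, 𝔼 θ, 𝔼 z, F (reprogram O (y, v, θ, z)) (y, v, θ, z) := fun y v => by
    rw [expect_prod, expect_prod]
    refine (expect_update y fun G θ => 𝔼 H : BoolFun m n, F (G, H) (y, v, θ, H v)).trans ?_
    refine Finset.expect_congr rfl fun G _ => ?_
    refine Eq.trans ?_ (Finset.expect_comm _ _ _)
    refine Finset.expect_congr rfl fun θ _ => ?_
    exact expect_update v fun H z => F (Function.update G y θ, H) (y, v, θ, z)
  simp only [sum_sampleProb_mul]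
  rw [Finset.expect_sum_comm, Finset.expect_sum_comm]
  refine Finset.sum_congr rfl fun y _ => ?_
  rw [← Finset.mul_expect, ← Finset.mul_expect]
  congr 1
  rw [Finset.expect_comm]
  exact (Finset.expect_congr rfl fun v _ => key y v).trans (Finset.expect_comm _ _ _)

theorem Sample.state_isQState (x : Sample n m) : IsQState x.state := by
  refine ⟨tens_posSemidef (ketbra_posSemidef _) (ketbra_posSemidef _), ?_⟩
  rw [Sample.state, trace_tens, trace_ketbra_ket, mul_one, ketbra_bb84, Matrix.trace]
  have h : ∀ θ v, ∑ b, bb84Qubit θ v b b = 1 := fun θ v => by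
    have : (1 : Matrix Bool Bool ℂ) = (if θ then hadamard else 1).conjTranspose *
        (if θ then hadamard else 1) := by
      cases θ
      · simp
      · simpa using hadamard_isometry.symm
    have h2 := congrFun (congrFun this v) v
    rw [Matrix.one_apply_eq, Matrix.mul_apply] at h2
    rw [h2]
    refine Finset.sum_congr rfl fun b _ => ?_
    rw [bb84Qubit, Matrix.vecMulVec_apply, Matrix.conjTranspose_apply, Pi.star_apply, mul_comm]
  have h2 := Finset.prod_univ_sum (fun _ : Fin m => (Finset.univ : Finset Bool))
    fun i b => bb84Qubit (x.2.2.1 i) (x.2.1 i) b b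
  rw [Fintype.piFinset_univ] at h2
  simp only [Matrix.diag, prodOp]
  rw [← h2]
  exact Finset.prod_eq_one fun i _ => h _ _

theorem maxMixed_isQState (k : ℕ) : IsQState (maxMixed k) := by
  refine ⟨Matrix.PosSemidef.one.smul ?_, ?_⟩
  · have : ((2 : ℂ) ^ k)⁻¹ = (((2 : ℝ) ^ k)⁻¹ : ℝ) := by push_cast; rfl
    rw [this]
    exact_mod_cast (by positivity : (0 : ℝ) ≤ (2 ^ k)⁻¹)
  · simp [maxMixed, Matrix.trace_smul]

/-- For every fixed basis, averaging the state over `v` and `z` yields the maximally mixed state. -/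
theorem expect_state (L : QOp (m + n) →ₗ[ℂ] ℂ) (y : Fin n → Bool) (θ : Fin m → Bool) :
    𝔼 v, 𝔼 z, (L (Sample.state (y, v, θ, z))).re = (L (maxMixed (m + n))).re := by
  have h : ∑ v, ∑ z, Sample.state (y, v, θ, z) = (1 : QOp (m + n)) := by
    have h1 : ∀ v, ∑ z, Sample.state (y, v, θ, z) = tens (ketbra (bb84 v θ)) (1 : QOp n) :=
      fun v => by
        rw [← sum_ketbra_ket]
        exact (map_sum (tensLeft (ketbra (bb84 v θ))) _ _).symm
    simp only [h1]
    rw [← tens_one_one, ← sum_ketbra_bb84 θ]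
    exact (map_sum (tensRight (1 : QOp n)) _ _).symm
  simp only [expect_bits, maxMixed, map_smul, ← Finset.mul_sum, ← Complex.re_sum, ← map_sum, h]
  have : ((2 : ℂ) ^ (m + n))⁻¹ = (((2 : ℝ) ^ (m + n))⁻¹ : ℝ) := by push_cast; rfl
  rw [this, smul_eq_mul, Complex.re_ofReal_mul, pow_add, mul_inv, mul_assoc]

theorem expect_sample_state (L : QOp (m + n) →ₗ[ℂ] ℂ) (y : Fin n → Bool) :
    𝔼 v, 𝔼 θ, 𝔼 z, (L (Sample.state (y, v, θ, z))).re = (L (maxMixed (m + n))).re := by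
  rw [Finset.expect_comm]
  simp only [expect_state]
  exact Finset.expect_const Finset.univ_nonempty _

/-- The optimal probability of guessing one BB84 bit without knowing the basis, `cos² (π / 8)`. -/
noncomputable def bb84Guess : ℝ := (1 + (√2)⁻¹) / 2

theorem half_le_bb84Guess : 1 / 2 ≤ bb84Guess := by
  rw [bb84Guess]
  have : 0 < (√2)⁻¹ := by positivity
  linarith

theorem bb84Guess_lt_one : bb84Guess < 1 := by
  rw [bb84Guess]
  have : (√2)⁻¹ < 1 := inv_lt_one_of_one_lt₀ (by
    rw [Real.lt_sqrt] <;> norm_num)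
  linarith

/-- No measurement of the state predicts `v` better than with probability `bb84Guess ^ m`. For each `v`,
the average of the state over the basis is at most `bb84Guess ^ m` times the identity. The functionals `W v`
play the measurement; their total is normalized to `T` instead of `1`. -/
theorem expect_guess_le (W : (Fin m → Bool) → QOp (m + n) →ₗ[ℂ] ℂ) {T : ℝ}
    (hW : ∀ v ρ, ρ.PosSemidef → 0 ≤ (W v ρ).re)
    (hT : ∀ ρ, ρ.PosSemidef → ∑ v, (W v ρ).re ≤ T * ρ.trace.re) (y : Fin n → Bool) :
    𝔼 v, 𝔼 θ, 𝔼 z, (W v (Sample.state (y, v, θ, z))).re ≤ bb84Guess ^ m * T := by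
  have h1 : ∀ v z, ∑ θ, (W v (Sample.state (y, v, θ, z))).re ≤
      (1 + (√2)⁻¹) ^ m * (W v (tens 1 (ketbra (ket z)))).re := fun v z => by
    have := hW v _ (tens_posSemidef (smul_one_sub_sum_ketbra_bb84_posSemidef v)
      (ketbra_posSemidef (ket z)))
    change 0 ≤ (W v (tensRight (ketbra (ket z)) _)).re at this
    rw [map_sub, map_sub, map_smul, map_smul, map_sum, map_sum, Complex.sub_re, smul_eq_mul,
      ← Complex.ofReal_pow, Complex.re_ofReal_mul, Complex.re_sum] at this
    exact sub_nonneg.1 this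
  have h2 : ∑ v, ∑ z, (W v (tens 1 (ketbra (ket z)))).re ≤ T * (2 ^ m * 2 ^ n) := by
    have h3 := hT (1 : QOp (m + n)) Matrix.PosSemidef.one
    have h4 : ∀ v, ∑ z, (W v (tens 1 (ketbra (ket z)))).re = (W v (1 : QOp (m + n))).re := fun v => by
      rw [← Complex.re_sum, ← map_sum, ← tens_one_one, ← sum_ketbra_ket (k := n)]
      exact congrArg (fun ρ => (W v ρ).re) (map_sum (tensLeft (1 : QOp m)) _ _).symm
    simp only [h4]
    refine h3.trans_eq ?_
    rw [Matrix.trace_one]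
    simp [pow_add]
    norm_cast
    simp
  simp only [expect_bits]
  have h5 : ∀ v, ∑ θ, (2 ^ n)⁻¹ * ∑ z, (W v (Sample.state (y, v, θ, z))).re ≤
      (2 ^ n)⁻¹ * ((1 + (√2)⁻¹) ^ m * ∑ z, (W v (tens 1 (ketbra (ket z)))).re) := fun v => by
    rw [← Finset.mul_sum, Finset.sum_comm, Finset.mul_sum (a := (1 + (√2)⁻¹) ^ m)]
    exact mul_le_mul_of_nonneg_left (Finset.sum_le_sum fun z _ => h1 v z) (by positivity)
  calc _ ≤ (2 ^ m)⁻¹ * ∑ v, (2 ^ m)⁻¹ * ((2 ^ n)⁻¹ *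
        ((1 + (√2)⁻¹) ^ m * ∑ z, (W v (tens 1 (ketbra (ket z)))).re)) :=
        mul_le_mul_of_nonneg_left (Finset.sum_le_sum fun v _ =>
          mul_le_mul_of_nonneg_left (h5 v) (by positivity)) (by positivity)
    _ = (2 ^ m)⁻¹ * ((2 ^ m)⁻¹ * ((2 ^ n)⁻¹ *
        ((1 + (√2)⁻¹) ^ m * ∑ v, ∑ z, (W v (tens 1 (ketbra (ket z)))).re))) := by
        simp only [Finset.mul_sum]
    _ ≤ (2 ^ m)⁻¹ * ((2 ^ m)⁻¹ * ((2 ^ n)⁻¹ *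
        ((1 + (√2)⁻¹) ^ m * (T * (2 ^ m * 2 ^ n))))) := by gcongr
    _ = bb84Guess ^ m * T := by
        rw [bb84Guess, div_pow]
        field_simp

end Game

/-! ### The second moment of the distinguishing advantage -/

section SampleMean

variable {n m : ℕ} {d : (Fin n → Bool) → ℝ}

/-- The expectation of `f x` over a sample `x` whose marked input has distribution `d`. -/
noncomputable def sampleMean (d : (Fin n → Bool) → ℝ) (f : Sample n m → ℝ) : ℝ :=
  ∑ x, sampleProb d x * f x

theorem sampleMean_add (f g : Sample n m → ℝ) :
    sampleMean d (fun x => f x + g x) = sampleMean d f + sampleMean d g := by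
  simp [sampleMean, mul_add, Finset.sum_add_distrib]

theorem sampleMean_sub (f g : Sample n m → ℝ) :
    sampleMean d (fun x => f x - g x) = sampleMean d f - sampleMean d g := by
  simp [sampleMean, mul_sub, Finset.sum_sub_distrib]

theorem sampleMean_const_mul (c : ℝ) (f : Sample n m → ℝ) :
    sampleMean d (fun x => c * f x) = c * sampleMean d f := by
  simp [sampleMean, Finset.mul_sum, mul_left_comm]

theorem sampleMean_mono (hd : ∀ y, 0 ≤ d y) {f g : Sample n m → ℝ} (h : ∀ x, f x ≤ g x) :
    sampleMean d f ≤ sampleMean d g :=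
  Finset.sum_le_sum fun x _ => mul_le_mul_of_nonneg_left (h x)
    (mul_nonneg (hd _) (by positivity))

theorem sampleMean_comm (f : Sample n m → Sample n m → ℝ) :
    (sampleMean d fun x => sampleMean d fun x' => f x x') =
      sampleMean d fun x' => sampleMean d fun x => f x x' := by
  simp only [sampleMean, Finset.mul_sum]
  rw [Finset.sum_comm]
  exact Finset.sum_congr rfl fun x' _ => Finset.sum_congr rfl fun x _ => mul_left_comm _ _ _

theorem sampleMean_marked (f : (Fin n → Bool) → ℝ) :
    sampleMean (m := m) d (fun x => f x.1) = ∑ y, d y * f y := by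
  simp only [sampleMean, sum_sampleProb_mul, Finset.expect_const Finset.univ_nonempty]

theorem sampleMean_const (hd1 : ∑ y, d y = 1) (c : ℝ) :
    sampleMean (m := m) d (fun _ => c) = c := by
  rw [sampleMean_marked (fun _ => c), ← Finset.sum_mul, hd1, one_mul]

theorem sampleMean_fresh (hd1 : ∑ y, d y = 1) (f : (Fin m → Bool) → ℝ) :
    sampleMean (m := m) d (fun x => f x.2.1) = (2 ^ m)⁻¹ * ∑ v, f v := by
  simp only [sampleMean, sum_sampleProb_mul, Finset.expect_const Finset.univ_nonempty]
  rw [← Finset.sum_mul, hd1, one_mul, expect_bits]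

end SampleMean

theorem sum_insert_le {α : Type*} [DecidableEq α] {f : α → ℝ} (hf : ∀ a, 0 ≤ f a) (a : α)
    (S : Finset α) : ∑ x ∈ insert a S, f x ≤ f a + ∑ x ∈ S, f x := by
  by_cases h : a ∈ S
  · rw [Finset.insert_eq_of_mem h]
    linarith [hf a]
  · rw [Finset.sum_insert h]

section SecondMoment

variable {n m q : ℕ} (C : Circuit n m (m + n + q) 1) (ν : QOp q)

/-- The advantage of a distinguisher in telling the state of a fixed sample from the maximally mixed
state. -/
noncomputable def Circuit.adv (O : BoolFun n m × BoolFun m n) (x : Sample n m) : ℝ :=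
  (C.accept ν O x.state).re - (C.accept ν O (maxMixed (m + n))).re

/-- The query weight on the two points at which a sample reprograms the oracles. -/
noncomputable def Circuit.hit (O : BoolFun n m × BoolFun m n) (x : Sample n m) (ρ : QOp (m + n)) : ℝ :=
  (C.weight ν O (.inl x.1) ρ).re + (C.weight ν O (.inr x.2.1) ρ).re

theorem agreeOff_reprogram (O : BoolFun n m × BoolFun m n) (x x' : Sample n m) :
    AgreeOff {.inl x.1, .inr x.2.1, .inl x'.1, .inr x'.2.1} O.1 (reprogram (reprogram O x') x).1
      O.2 (reprogram (reprogram O x') x).2 := by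
  constructor
  · intro y hy
    simp only [Finset.mem_insert, Finset.mem_singleton, Sum.inl.injEq, reduceCtorEq, or_false,
      false_or, not_or] at hy
    simp [reprogram, hy.1, hy.2]
  · intro v hv
    simp only [Finset.mem_insert, Finset.mem_singleton, Sum.inr.injEq, reduceCtorEq,
      false_or, not_or] at hv
    simp [reprogram, hv.1, hv.2]

variable {ν} (hν : IsQState ν)

include hν

theorem Circuit.abs_adv_le_one (O : BoolFun n m × BoolFun m n) (x : Sample n m) :
    |C.adv ν O x| ≤ 1 := by
  have h1 := C.accept_isEffect hν O _ x.state_isQState.1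
  have h2 := C.accept_isEffect hν O _ (maxMixed_isQState (m + n)).1
  rw [x.state_isQState.2] at h1
  rw [(maxMixed_isQState (m + n)).2] at h2
  rw [Complex.one_re] at h1 h2
  rw [Circuit.adv, abs_le]
  constructor <;> linarith

theorem Circuit.abs_adv_reprogram_sub_le (O : BoolFun n m × BoolFun m n) (x x' t : Sample n m)
    {s : ℝ} (hs : s ≠ 0) :
    |C.adv ν (reprogram (reprogram O x') x) t - C.adv ν O t| ≤
      2 * (C.gates.length * s ^ 2) + 4 * (1 + (s ^ 2)⁻¹) *
        (C.hit ν O x t.state + C.hit ν O x' t.state +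
          (C.hit ν O x (maxMixed (m + n)) + C.hit ν O x' (maxMixed (m + n)))) := by
  have key : ∀ ρ : QOp (m + n), IsQState ρ →
      |(C.accept ν (reprogram (reprogram O x') x) ρ).re - (C.accept ν O ρ).re| ≤
        C.gates.length * s ^ 2 + 4 * (1 + (s ^ 2)⁻¹) * (C.hit ν O x ρ + C.hit ν O x' ρ) := by
    intro ρ hρ
    refine (C.abs_accept_sub_le hν O (agreeOff_reprogram O x x') hρ hs).trans ?_
    have h0 := fun p => C.weight_nonneg hν O p hρ.1
    gcongr
    refine (sum_insert_le h0 _ _).trans ?_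
    rw [Circuit.hit, Circuit.hit, add_assoc]
    gcongr
    refine (sum_insert_le h0 _ _).trans ?_
    gcongr
    refine (sum_insert_le h0 _ _).trans ?_
    gcongr
    rw [Finset.sum_singleton]
  have h1 := key _ t.state_isQState
  have h2 := key _ (maxMixed_isQState (m + n))
  rw [abs_le] at h1 h2 ⊢
  simp only [Circuit.adv]
  constructor <;> linarith

-- Both guessing probabilities, of the marked input and of a string in unknown bases, are at most `s ^ 4`.
-- The same `s` serves as the parameter of the hybrid argument, where the errors become `s ^ 2` and
-- `s ^ 4 / s ^ 2`.
variable {d : (Fin n → Bool) → ℝ} (hd : ∀ y, 0 ≤ d y) (hd1 : ∑ y, d y = 1) {s : ℝ}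
  (hds : ∀ y, d y ≤ s ^ 4) (hms : bb84Guess ^ m ≤ s ^ 4)

omit hν in
include hms in
theorem inv_two_pow_le : ((2 : ℝ) ^ m)⁻¹ ≤ s ^ 4 := by
  refine le_trans ?_ hms
  rw [← inv_pow]
  exact pow_le_pow_left₀ (by norm_num) (by linarith [half_le_bb84Guess]) _

include hds in
theorem Circuit.sum_marked_weight_le (O : BoolFun n m × BoolFun m n) {ρ : QOp (m + n)}
    (hρ : IsQState ρ) : ∑ y, d y * (C.weight ν O (.inl y) ρ).re ≤ s ^ 4 * C.gates.length := by
  have h1 := C.sum_weight_comp_le hν O ⟨Sum.inl, Sum.inl_injective⟩ hρ.1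
  rw [hρ.2, Complex.one_re, mul_one] at h1
  refine le_trans ?_ (mul_le_mul_of_nonneg_left h1 (by positivity : (0 : ℝ) ≤ s ^ 4))
  rw [Finset.mul_sum]
  exact Finset.sum_le_sum fun y _ => mul_le_mul_of_nonneg_right (hds y) (C.weight_nonneg hν O _ hρ.1)

include hd hd1 hds hms

omit hd in
/-- A run on an input that is independent of the sample rarely queries the points of the sample. -/
theorem Circuit.sampleMean_hit_le (O : BoolFun n m × BoolFun m n) {ρ : QOp (m + n)}
    (hρ : IsQState ρ) : sampleMean d (fun x => C.hit ν O x ρ) ≤ 2 * (s ^ 4 * C.gates.length) := by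
  simp only [Circuit.hit, sampleMean_add]
  rw [sampleMean_marked fun y => (C.weight ν O (.inl y) ρ).re,
    sampleMean_fresh hd1 fun v => (C.weight ν O (.inr v) ρ).re]
  have h1 := C.sum_marked_weight_le hν hds O hρ
  have h2 := C.sum_weight_comp_le hν O ⟨Sum.inr, Sum.inr_injective⟩ hρ.1
  rw [hρ.2, Complex.one_re, mul_one] at h2
  have h3 := mul_le_mul (inv_two_pow_le hms) h2
    (Finset.sum_nonneg fun v _ => C.weight_nonneg hν O _ hρ.1) (by positivity)
  simp only [Function.Embedding.coeFn_mk] at h3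
  linarith

/-- A run on the state of the sample rarely queries the points of the sample: the state is independent of
`y`, and it does not reveal `v`, because the basis is unknown. -/
theorem Circuit.sampleMean_hit_self_le (O : BoolFun n m × BoolFun m n) :
    sampleMean d (fun x => C.hit ν O x x.state) ≤ 2 * (s ^ 4 * C.gates.length) := by
  simp only [Circuit.hit, sampleMean_add]
  have h1 : sampleMean d (fun x : Sample n m => (C.weight ν O (.inl x.1) x.state).re) ≤
      s ^ 4 * C.gates.length := by
    simp only [sampleMean, sum_sampleProb_mul, expect_sample_state]
    exact C.sum_marked_weight_le hν hds O (maxMixed_isQState _)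
  have h2 : sampleMean d (fun x : Sample n m => (C.weight ν O (.inr x.2.1) x.state).re) ≤
      s ^ 4 * C.gates.length := by
    simp only [sampleMean, sum_sampleProb_mul]
    have h3 : ∀ y, 𝔼 v, 𝔼 θ, 𝔼 z,
        (C.weight ν O (.inr v) (Sample.state (y, v, θ, z))).re ≤ s ^ 4 * C.gates.length := fun y =>
      (expect_guess_le (fun v => C.weight ν O (.inr v))
        (fun v ρ hρ => C.weight_nonneg hν O _ hρ)
        (fun ρ hρ => C.sum_weight_comp_le hν O ⟨Sum.inr, Sum.inr_injective⟩ hρ) y).trans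
        (by gcongr)
    calc _ ≤ ∑ y, d y * (s ^ 4 * C.gates.length) :=
          Finset.sum_le_sum fun y _ => mul_le_mul_of_nonneg_left (h3 y) (hd y)
      _ = _ := by rw [← Finset.sum_mul, hd1, one_mul]
  linarith

omit hν hd hd1 hms in
theorem sampleMean_marked_eq_le (y : Fin n → Bool) :
    sampleMean (m := m) d (fun x => if y = x.1 then 1 else 0) ≤ s ^ 4 := by
  rw [sampleMean_marked fun y' => if y = y' then 1 else 0]
  simpa using hds y

omit hν hd hds in
theorem sampleMean_fresh_eq_le (v : Fin m → Bool) :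
    sampleMean d (fun x => if v = x.2.1 then 1 else 0) ≤ s ^ 4 := by
  rw [sampleMean_fresh hd1 fun v' => if v = v' then 1 else 0]
  simpa using inv_two_pow_le hms

omit hd hd1 hds hms in
/-- Off collisions, the product of the advantages of two samples changes only little if the two samples
are used to reprogram the oracles. -/
theorem Circuit.adv_mul_adv_le (O : BoolFun n m × BoolFun m n) (x x' : Sample n m) :
    C.adv ν (reprogram (reprogram O x') x) x *
      C.adv ν (reprogram (reprogram O x') x)
        (readSample (reprogram (reprogram O x') x) x'.1 x'.2.1) ≤
    C.adv ν O x * C.adv ν O x' + 2 * (if x.1 = x'.1 then 1 else 0) +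
      2 * (if x.2.1 = x'.2.1 then 1 else 0) +
      |C.adv ν (reprogram (reprogram O x') x) x - C.adv ν O x| +
      |C.adv ν (reprogram (reprogram O x') x) x' - C.adv ν O x'| := by
  set O₂ := reprogram (reprogram O x') x
  have prod_le : ∀ a b : ℝ, |a| ≤ 1 → |b| ≤ 1 → |a * b| ≤ 1 := fun a b ha hb => by
    rw [abs_mul]; exact mul_le_one₀ ha (abs_nonneg b) hb
  by_cases h : x.1 = x'.1 ∨ x.2.1 = x'.2.1
  · have h1 := (abs_le.1 (prod_le _ _ (C.abs_adv_le_one hν O₂ x)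
      (C.abs_adv_le_one hν O₂ (readSample O₂ x'.1 x'.2.1)))).2
    have h2 := (abs_le.1 (prod_le _ _ (C.abs_adv_le_one hν O x)
      (C.abs_adv_le_one hν O x'))).1
    have h3 : (2 : ℝ) ≤ 2 * (if x.1 = x'.1 then 1 else 0) +
        2 * (if x.2.1 = x'.2.1 then 1 else 0) := by
      rcases h with h | h <;> simp only [h, if_true] <;> split_ifs <;> norm_num
    have h4 := abs_nonneg (C.adv ν O₂ x - C.adv ν O x)
    have h5 := abs_nonneg (C.adv ν O₂ x' - C.adv ν O x')
    linarith
  · rw [not_or] at h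
    have hr : readSample O₂ x'.1 x'.2.1 = x' := by
      simp [readSample, O₂, reprogram, Function.update_of_ne (Ne.symm h.1),
        Function.update_of_ne (Ne.symm h.2)]
    rw [hr, if_neg h.1, if_neg h.2]
    have e : C.adv ν O₂ x * C.adv ν O₂ x' - C.adv ν O x * C.adv ν O x' =
        (C.adv ν O₂ x - C.adv ν O x) * C.adv ν O₂ x' +
          C.adv ν O x * (C.adv ν O₂ x' - C.adv ν O x') := by ring
    have h1 : (C.adv ν O₂ x - C.adv ν O x) * C.adv ν O₂ x' ≤ |C.adv ν O₂ x - C.adv ν O x| := by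
      refine (le_abs_self _).trans ?_
      rw [abs_mul]
      exact mul_le_of_le_one_right (abs_nonneg _) (C.abs_adv_le_one hν _ _)
    have h2 : C.adv ν O x * (C.adv ν O₂ x' - C.adv ν O x') ≤ |C.adv ν O₂ x' - C.adv ν O x'| := by
      refine (le_abs_self _).trans ?_
      rw [abs_mul]
      exact mul_le_of_le_one_left (abs_nonneg _) (C.abs_adv_le_one hν _ _)
    linarith

omit hν hds hms hd in
/-- The advantage vanishes on average over the samples, for oracles independent of the sample. -/
theorem Circuit.sampleMean_adv (O : BoolFun n m × BoolFun m n) : sampleMean d (C.adv ν O) = 0 := by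
  have h : sampleMean d (fun x : Sample n m => (C.accept ν O x.state).re) =
      (C.accept ν O (maxMixed (m + n))).re := by
    simp only [sampleMean, sum_sampleProb_mul, expect_sample_state]
    rw [← Finset.sum_mul, hd1, one_mul]
  unfold Circuit.adv
  rw [sampleMean_sub, h, sampleMean_const hd1, sub_self]

/-- The second moment of the advantage, for independent oracles, of a distinguisher that is given a state
prepared from the answers of the oracles. -/
theorem Circuit.expect_sq_le (hs0 : 0 < s) (hs1 : s ≤ 1) :
    𝔼 O, (∑ y, d y * 𝔼 v, C.adv ν O (readSample O y v)) ^ 2 ≤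
      132 * (C.gates.length + 1) * s ^ 2 := by
  set T : ℝ := (C.gates.length : ℝ)
  have hT : 0 ≤ T := Nat.cast_nonneg _
  -- Lazy sampling for the first factor, and then for the second one.
  have e : 𝔼 O, (∑ y, d y * 𝔼 v, C.adv ν O (readSample O y v)) ^ 2 =
      𝔼 O, sampleMean d fun x => sampleMean d fun x' =>
        C.adv ν (reprogram (reprogram O x') x) x *
          C.adv ν (reprogram (reprogram O x') x)
            (readSample (reprogram (reprogram O x') x) x'.1 x'.2.1) := by
    have h1 := expect_readSample (m := m) d fun O x =>
      C.adv ν O x * ∑ y, d y * 𝔼 v, C.adv ν O (readSample O y v)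
    have h2 : ∀ x : Sample n m, 𝔼 O, (C.adv ν (reprogram O x) x *
        ∑ y, d y * 𝔼 v, C.adv ν (reprogram O x) (readSample (reprogram O x) y v)) =
        𝔼 O, sampleMean d fun x' =>
        C.adv ν (reprogram (reprogram O x') x) x *
          C.adv ν (reprogram (reprogram O x') x)
            (readSample (reprogram (reprogram O x') x) x'.1 x'.2.1) := fun x => by
      have := expect_readSample (m := m) d fun O x' => C.adv ν (reprogram O x) x *
        C.adv ν (reprogram O x) (readSample (reprogram O x) x'.1 x'.2.1)
      refine Eq.trans ?_ this
      refine Finset.expect_congr rfl fun O _ => ?_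
      rw [Finset.mul_sum]
      refine Finset.sum_congr rfl fun y _ => ?_
      rw [mul_left_comm, Finset.mul_expect]
      rfl
    refine Eq.trans ?_ (h1.trans ?_)
    · refine Finset.expect_congr rfl fun O _ => ?_
      rw [pow_two, Finset.sum_mul]
      refine Finset.sum_congr rfl fun y _ => ?_
      rw [mul_assoc, Finset.expect_mul]
    · simp only [sampleMean]
      rw [Finset.expect_sum_comm, Finset.expect_sum_comm]
      refine Finset.sum_congr rfl fun x _ => ?_
      rw [← Finset.mul_expect, ← Finset.mul_expect, h2]
      rfl
  rw [e]
  -- From here on the oracles are fixed, and only the two independent samples are random.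
  refine Finset.expect_le (s := Finset.univ) Finset.univ_nonempty fun O _ => ?_
  set K : ℝ := 4 * (1 + (s ^ 2)⁻¹) with hK
  set M := maxMixed (m + n)
  have hmono : (sampleMean d fun x => sampleMean d fun x' =>
        C.adv ν (reprogram (reprogram O x') x) x *
          C.adv ν (reprogram (reprogram O x') x)
            (readSample (reprogram (reprogram O x') x) x'.1 x'.2.1)) ≤
      sampleMean d fun x => sampleMean d fun x' =>
        C.adv ν O x * C.adv ν O x' + 2 * (if x.1 = x'.1 then 1 else 0) +
        2 * (if x.2.1 = x'.2.1 then 1 else 0) +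
        (2 * (T * s ^ 2) + K * (C.hit ν O x x.state + C.hit ν O x' x.state +
          (C.hit ν O x M + C.hit ν O x' M))) +
        (2 * (T * s ^ 2) + K * (C.hit ν O x x'.state + C.hit ν O x' x'.state +
          (C.hit ν O x M + C.hit ν O x' M))) :=
    sampleMean_mono hd fun x => sampleMean_mono hd fun x' =>
      (C.adv_mul_adv_le hν O x x').trans (by
        gcongr
        exacts [C.abs_adv_reprogram_sub_le hν O x x' x hs0.ne',
          C.abs_adv_reprogram_sub_le hν O x x' x' hs0.ne'])
  refine hmono.trans ?_
  simp only [sampleMean_add, sampleMean_const_mul, sampleMean_const hd1, C.sampleMean_adv hd1,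
    mul_zero]
  have hle : ∀ {f : Sample n m → ℝ} {c : ℝ}, (∀ x, f x ≤ c) → sampleMean d f ≤ c := fun h =>
    (sampleMean_mono hd h).trans_eq (sampleMean_const hd1 _)
  have c1 : (sampleMean d fun x : Sample n m =>
      sampleMean d fun x' : Sample n m => if x.1 = x'.1 then 1 else 0) ≤ s ^ 4 :=
    hle fun x => sampleMean_marked_eq_le hds x.1
  have c2 : (sampleMean d fun x : Sample n m =>
      sampleMean d fun x' : Sample n m => if x.2.1 = x'.2.1 then 1 else 0) ≤ s ^ 4 :=
    hle fun x => sampleMean_fresh_eq_le hd1 hms x.2.1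
  have c3 := C.sampleMean_hit_self_le hν hd hd1 hds hms O
  have c4 := C.sampleMean_hit_le hν hd1 hds hms O (maxMixed_isQState (m + n))
  have c5 : (sampleMean d fun x : Sample n m => sampleMean d fun x' => C.hit ν O x' x.state) ≤
      2 * (s ^ 4 * T) :=
    hle fun x => C.sampleMean_hit_le hν hd1 hds hms O x.state_isQState
  rw [sampleMean_comm fun x x' : Sample n m => C.hit ν O x x'.state]
  have hs4 : s ^ 4 ≤ s ^ 2 := pow_le_pow_of_le_one hs0.le hs1 (by norm_num)
  have hK0 : 0 ≤ K := by positivity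
  have hK4 : K * (8 * (s ^ 4 * T)) ≤ 64 * (s ^ 2 * T) := by
    have : K * (8 * (s ^ 4 * T)) = 32 * (s ^ 4 + s ^ 2) * T := by
      rw [hK]
      field_simp
      ring
    rw [this]
    nlinarith [mul_le_mul_of_nonneg_right hs4 hT]
  have hX : ∀ X, X ≤ 8 * (s ^ 4 * T) → K * X ≤ 64 * (s ^ 2 * T) := fun X hX =>
    (mul_le_mul_of_nonneg_left hX hK0).trans hK4
  have hX1 := hX _ (show _ ≤ _ from add_le_add (add_le_add c3 c5) (add_le_add c4 c4) |>.trans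
    (by linarith))
  have hX2 := hX _ (show _ ≤ _ from add_le_add (add_le_add c5 c3) (add_le_add c4 c4) |>.trans
    (by linarith))
  nlinarith

/-- The first absolute moment of the advantage, by `|X| ≤ s + X ^ 2 / s`. -/
theorem Circuit.expect_abs_le (hs0 : 0 < s) (hs1 : s ≤ 1) :
    𝔼 O, |∑ y, d y * 𝔼 v, C.adv ν O (readSample O y v)| ≤ 133 * (C.gates.length + 1) * s := by
  have h1 : ∀ X : ℝ, |X| ≤ s + s⁻¹ * X ^ 2 := fun X => by
    have h2 : s * (s + s⁻¹ * X ^ 2 - |X|) = (s - |X|) ^ 2 + s * |X| := by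
      rw [← sq_abs X]
      field_simp
      ring
    have h3 : 0 ≤ s * (s + s⁻¹ * X ^ 2 - |X|) := by
      rw [h2]
      positivity
    linarith [nonneg_of_mul_nonneg_right h3 hs0]
  have h2 := C.expect_sq_le hν hd hd1 hds hms hs0 hs1
  calc _ ≤ 𝔼 O, (s + s⁻¹ * (∑ y, d y * 𝔼 v, C.adv ν O (readSample O y v)) ^ 2) :=
        Finset.expect_le_expect fun O _ => h1 _
    _ = s + s⁻¹ * 𝔼 O, (∑ y, d y * 𝔼 v, C.adv ν O (readSample O y v)) ^ 2 := by
        rw [Finset.expect_add_distrib, Finset.expect_const Finset.univ_nonempty, Finset.mul_expect]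
    _ ≤ s + s⁻¹ * (132 * (C.gates.length + 1) * s ^ 2) := by gcongr
    _ = s + 132 * (C.gates.length + 1) * s := by field_simp
    _ ≤ 133 * (C.gates.length + 1) * s := by
        have : 0 ≤ (C.gates.length : ℝ) * s := by positivity
        linarith

end SecondMoment

/-! ### Asymptotics -/

section Asymptotic

theorem polynomial_eval_mono (p : Polynomial ℕ) : Monotone fun x => p.eval x := by
  intro x y h
  simp only [Polynomial.eval_eq_sum, Polynomial.sum]
  exact Finset.sum_le_sum fun i _ => Nat.mul_le_mul_left _ (Nat.pow_le_pow_left h i)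

theorem PolyBounded.comp_polynomial {f : ℕ → ℕ} (hf : PolyBounded f) (p : Polynomial ℕ) :
    PolyBounded fun n => p.eval (f n) := by
  obtain ⟨r, hr⟩ := hf
  exact ⟨p.comp r, fun n => by
    rw [Polynomial.eval_comp]
    exact polynomial_eval_mono p (hr n)⟩

theorem PolyBounded.add {f g : ℕ → ℕ} (hf : PolyBounded f) (hg : PolyBounded g) :
    PolyBounded fun n => f n + g n := by
  obtain ⟨r, hr⟩ := hf
  obtain ⟨t, ht⟩ := hg
  exact ⟨r + t, fun n => by rw [Polynomial.eval_add]; exact add_le_add (hr n) (ht n)⟩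

theorem polyBounded_id : PolyBounded fun n => n := ⟨Polynomial.X, fun n => by simp⟩

/-- The function `exp (-c n ^ ε)` decays faster than every polynomial. -/
theorem negligible_exp_neg_rpow {c ε : ℝ} (hc : 0 < c) (hε : 0 < ε) :
    Negligible fun n => Real.exp (-c * (n : ℝ) ^ ε) := by
  intro k
  have h := (tendsto_rpow_mul_exp_neg_mul_atTop_nhds_zero (k / ε) c hc).comp
    ((tendsto_rpow_atTop hε).comp tendsto_natCast_atTop_atTop)
  refine h.congr fun n => ?_
  simp only [Function.comp_apply]
  rw [← Real.rpow_mul (Nat.cast_nonneg n), mul_div_cancel₀ _ hε.ne', Real.rpow_natCast]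

theorem Negligible.of_le_polyBounded_mul {f s : ℕ → ℝ} {T : ℕ → ℕ} (hs : Negligible s)
    (hT : PolyBounded T) (hs0 : ∀ n, 0 ≤ s n) (hf0 : ∀ n, 0 ≤ f n) {K : ℝ} (hK : 0 ≤ K)
    (hf : ∀ n, f n ≤ K * (T n + 1) * s n) : Negligible f := by
  obtain ⟨r, hr⟩ := hT
  have h := hs.polynomial_mul (Polynomial.C K * ((r + 1).map (Nat.castRingHom ℝ)))
  refine h.trans_eventually_abs_le (Filter.Eventually.of_forall fun n => ?_)
  have h1 : Polynomial.eval (n : ℝ) (Polynomial.C K * ((r + 1).map (Nat.castRingHom ℝ))) =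
      K * ((r.eval n : ℕ) + 1) := by
    rw [Polynomial.eval_mul, Polynomial.eval_C, Polynomial.eval_natCast_map]
    simp
  have h2 : f n ≤ K * ((r.eval n : ℕ) + 1) * s n := by
    refine (hf n).trans ?_
    have := hs0 n
    have : (T n : ℝ) ≤ (r.eval n : ℕ) := by exact_mod_cast hr n
    gcongr
  simp only [Function.comp_apply, h1]
  rwa [abs_of_nonneg (hf0 n), abs_of_nonneg ((hf0 n).trans h2)]

theorem sum_pmf_toReal {α : Type} [Fintype α] (D : PMF α) : ∑ y, (D y).toReal = 1 := by
  rw [← ENNReal.toReal_sum fun y _ => D.apply_ne_top y, ← tsum_fintype (L := .unconditional _), D.tsum_coe,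
    ENNReal.toReal_one]

theorem toReal_le_of_le_minEntropy {k : ℕ} (D : PMF (Fin k → Bool)) {h : ℝ}
    (hD : h ≤ minEntropy D) (y : Fin k → Bool) : (D y).toReal ≤ Real.exp (-(Real.log 2 * h)) := by
  have hle : ∀ y, (D y).toReal ≤ ⨆ y, (D y).toReal :=
    le_ciSup (f := fun y => (D y).toReal) (Set.finite_range _).bddAbove
  have hpos : 0 < ⨆ y, (D y).toReal := by
    by_contra hneg
    have : ∑ y, (D y).toReal ≤ 0 := Finset.sum_nonpos fun y _ => (hle y).trans (not_lt.1 hneg)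
    rw [sum_pmf_toReal] at this
    linarith
  refine (hle y).trans ?_
  have h1 := (Real.logb_le_iff_le_rpow one_lt_two hpos).1 (by rw [minEntropy] at hD; linarith :
    Real.logb 2 (⨆ y, (D y).toReal) ≤ -h)
  refine h1.trans_eq ?_
  rw [Real.rpow_def_of_pos two_pos, mul_neg]

end Asymptotic

/-! ### Indistinguishability from the maximally mixed state -/

/-- The advantage in the security game is the mean, over `y` and `v`, of the advantages on the samples read
from the oracles. -/
theorem QPTAlgorithm.prOne_sub_prOne_eq {n m q : ℕ} (A : QPTDistinguisher) (D : PMF (Fin n → Bool))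
    (ν : QOp q) (O : BoolFun n m × BoolFun m n) :
    A.prOne O.1 O.2 (tens (avgState D fun y => cpProtect O.1 O.2 y) ν) -
        A.prOne O.1 O.2 (tens (maxMixed (m + n)) ν) =
      ∑ y, (D y).toReal * 𝔼 v, (A.circ n m (m + n + q)).adv ν O (readSample O y v) := by
  simp only [QPTAlgorithm.prOne, QPTAlgorithm.run]
  rw [Circuit.run_eq_accept, Circuit.run_eq_accept]
  set C := A.circ n m (m + n + q)
  have h1 : ∀ y, 𝔼 v, C.adv ν O (readSample O y v) =
      (C.accept ν O (cpProtect O.1 O.2 y)).re - (C.accept ν O (maxMixed (m + n))).re := fun y => by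
    have h2 : cpProtect O.1 O.2 y = ((2 : ℂ) ^ m)⁻¹ • ∑ v, (readSample O y v).state := rfl
    have h3 : ((2 : ℂ) ^ m)⁻¹ = (((2 : ℝ) ^ m)⁻¹ : ℝ) := by push_cast; rfl
    unfold Circuit.adv
    rw [Finset.expect_sub_distrib, Finset.expect_const Finset.univ_nonempty, expect_bits, h2, h3,
      map_smul, map_sum, smul_eq_mul, Complex.re_ofReal_mul, Complex.re_sum]
  simp only [h1, mul_sub, Finset.sum_sub_distrib]
  rw [← Finset.sum_mul, sum_pmf_toReal, one_mul, avgState, map_sum, Complex.re_sum]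
  simp only [map_smul, smul_eq_mul, Complex.re_ofReal_mul]

theorem compIndistQROM_maxMixed {m : ℕ → ℕ} (hm : ∀ n, n < m n) (hpoly : PolyBounded m)
    {D : PFEnsemble} (hD : D ∈ UnpredictablePF) :
    CompIndistQROM m (fun n => m n + n)
      (fun n G H => avgState (D n) (fun y => cpProtect G H y))
      (fun n _ _ => maxMixed (m n + n)) := by
  obtain ⟨ε, hε, hD⟩ := hD
  intro A q hq ν hν
  obtain ⟨p, hp⟩ := A.exists_gates_length_le
  have hT : PolyBounded fun n => p.eval (n + m n + (m n + n + q n)) :=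
    ((polyBounded_id.add hpoly).add ((hpoly.add polyBounded_id).add hq)).comp_polynomial p
  -- The fourth power of the decaying factor bounds both guessing probabilities, of `y` and of `v`.
  have hg0 : 0 < bb84Guess := by linarith [half_le_bb84Guess]
  set b : ℝ := -Real.log bb84Guess with hb
  have hb0 : 0 < b := neg_pos.2 (Real.log_neg hg0 bb84Guess_lt_one)
  have hb2 : b ≤ Real.log 2 := by
    have := Real.log_le_log (by norm_num) half_le_bb84Guess
    rw [one_div, Real.log_inv] at this
    linarith
  -- The exponent is capped at `1` since `m n > n` only makes the guessing probability of `v`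
  -- exponentially small in `n`.
  set δ : ℝ := min ε 1
  have hδ : 0 < δ := lt_min hε one_pos
  set s : ℕ → ℝ := fun n => Real.exp (-(b / 4) * (n : ℝ) ^ δ) with hs
  have hs4 : ∀ n, s n ^ 4 = Real.exp (-(b * (n : ℝ) ^ δ)) := fun n => by
    rw [hs, ← Real.exp_nat_mul]
    congr 1
    push_cast
    ring
  have hpow : ∀ (n : ℕ) (t : ℝ), δ ≤ t → (n : ℝ) ^ δ ≤ (n : ℝ) ^ t := fun n t ht => by
    rcases Nat.eq_zero_or_pos n with rfl | hn
    · rw [Nat.cast_zero, Real.zero_rpow hδ.ne', Real.zero_rpow (hδ.trans_le ht).ne']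
    · exact Real.rpow_le_rpow_of_exponent_le (by exact_mod_cast hn) ht
  have hnn : ∀ n : ℕ, 0 ≤ (n : ℝ) ^ δ := fun n => by positivity
  have key : ∀ n, 𝔼 O, |∑ y, (D n y).toReal * 𝔼 v,
      (A.circ n (m n) (m n + n + q n)).adv (ν n) O (readSample O y v)| ≤
        133 * ((A.circ n (m n) (m n + n + q n)).gates.length + 1) * s n := fun n => by
    refine Circuit.expect_abs_le _ (hν n) (fun _ => ENNReal.toReal_nonneg) (sum_pmf_toReal _)
      (fun y => ?_) ?_ (Real.exp_pos _) ?_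
    · rw [hs4]
      refine (toReal_le_of_le_minEntropy _ (hD n) y).trans (Real.exp_le_exp.2 (neg_le_neg ?_))
      exact mul_le_mul hb2 (hpow n ε (min_le_left _ _)) (hnn n) (hb0.le.trans hb2)
    · rw [hs4]
      refine (pow_le_pow_of_le_one hg0.le bb84Guess_lt_one.le (hm n).le).trans ?_
      rw [← Real.exp_log hg0, ← Real.exp_nat_mul, Real.exp_le_exp]
      have := mul_le_mul_of_nonneg_left (hpow n 1 (min_le_right _ _)) hb0.le
      rw [Real.rpow_one] at this
      rw [hb] at this ⊢
      linarith
    · rw [hs, Real.exp_le_one_iff]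
      nlinarith [mul_nonneg hb0.le (hnn n)]
  refine (negligible_exp_neg_rpow (by positivity : 0 < b / 4) hδ).of_le_polyBounded_mul hT
    (fun n => (Real.exp_pos _).le) (fun n => ?_) (by norm_num : (0 : ℝ) ≤ 133) fun n => ?_
  · exact Finset.expect_nonneg fun G _ => Finset.expect_nonneg fun H _ => abs_nonneg _
  · have h1 := key n
    rw [expect_prod] at h1
    simp only [← A.prOne_sub_prOne_eq (D n)] at h1
    refine h1.trans ?_
    have h2 : ((A.circ n (m n) (m n + n + q n)).gates.length : ℝ) ≤
        (p.eval (n + m n + (m n + n + q n)) : ℕ) := by exact_mod_cast hp _ _ _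
    have := (Real.exp_pos (-(b / 4) * (n : ℝ) ^ δ)).le
    gcongr

/-! ### Gates acting on product operators -/

section ProdOpGates

variable {n m k l w : ℕ}

theorem prodOp_mul (A B : Fin w → Matrix Bool Bool ℂ) :
    prodOp A * prodOp B = prodOp fun i => A i * B i := by
  ext x y
  rw [Matrix.mul_apply]
  simp only [prodOp, Matrix.mul_apply, ← Finset.prod_mul_distrib]
  rw [Finset.prod_univ_sum, Fintype.piFinset_univ]

theorem prodOp_conjTranspose (A : Fin w → Matrix Bool Bool ℂ) :
    (prodOp A).conjTranspose = prodOp fun i => (A i).conjTranspose := by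
  ext x y
  simp [prodOp, Matrix.conjTranspose_apply]

/-- The projector `|b⟩⟨b|` on a qubit. -/
def bitProj (b : Bool) : Matrix Bool Bool ℂ := fun x y => if x = b ∧ y = b then 1 else 0

theorem bitProj_conjTranspose (b : Bool) : (bitProj b).conjTranspose = bitProj b := by
  ext x y
  simp only [bitProj, Matrix.conjTranspose_apply, and_comm]
  split_ifs <;> simp

theorem bitProj_mul (b c : Bool) : bitProj b * bitProj c = if b = c then bitProj c else 0 := by
  ext x y
  rw [Matrix.mul_apply, Fintype.sum_bool]
  cases b <;> cases c <;> cases x <;> cases y <;> simp [bitProj]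

theorem ketbra_ket_eq_prodOp (x : Fin w → Bool) : ketbra (ket x) = prodOp fun i => bitProj (x i) := by
  ext b c
  rw [ketbra_ket_apply]
  simp only [prodOp, bitProj, Finset.prod_ite_zero, Finset.prod_const_one, Finset.mem_univ,
    true_implies, funext_iff, forall_and]

theorem onWire_eq_prodOp (i : Fin w) (U : Matrix Bool Bool ℂ) :
    onWire i U = prodOp (Function.update (fun _ => 1) i U) := by
  ext b c
  rw [prodOp, ← Finset.mul_prod_erase _ _ (Finset.mem_univ i), Function.update_self]
  have h : ∀ j ∈ Finset.univ.erase i, Function.update (fun _ => (1 : Matrix Bool Bool ℂ)) i U j (b j) (c j) =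
      if b j = c j then 1 else 0 := fun j hj => by
    rw [Function.update_of_ne (Finset.ne_of_mem_erase hj), Matrix.one_apply]
  rw [Finset.prod_congr rfl h, Finset.prod_ite_zero]
  have h2 : (∀ j, j ∉ Set.range (fun _ : Unit => i) → b j = c j) ↔
      ∀ j ∈ Finset.univ.erase i, b j = c j := by simp [eq_comm]
  by_cases hr : ∀ j, j ∉ Set.range (fun _ : Unit => i) → b j = c j
  · rw [if_pos (h2.1 hr), Finset.prod_const_one, mul_one]
    exact if_pos hr
  · rw [if_neg (mt h2.2 hr), mul_zero]
    exact if_neg hr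

theorem onWire_conj_prodOp (i : Fin w) (U : Matrix Bool Bool ℂ) (A : Fin w → Matrix Bool Bool ℂ) :
    onWire i U * prodOp A * (onWire i U).conjTranspose =
      prodOp (Function.update A i (U * A i * U.conjTranspose)) := by
  rw [onWire_eq_prodOp, prodOp_conjTranspose, prodOp_mul, prodOp_mul]
  congr 1
  funext j
  by_cases h : j = i
  · subst h; simp
  · simp [Function.update_of_ne h]

theorem prodOp_update_apply (A : Fin w → Matrix Bool Bool ℂ) (i : Fin w) (B : Matrix Bool Bool ℂ)
    (b c : Fin w → Bool) : prodOp (Function.update A i B) b c =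
      B (b i) (c i) * ∏ j ∈ Finset.univ.erase i, A j (b j) (c j) := by
  rw [prodOp, ← Finset.mul_prod_erase _ _ (Finset.mem_univ i), Function.update_self]
  congr 1
  exact Finset.prod_congr rfl fun j hj => by
    rw [Function.update_of_ne (Finset.ne_of_mem_erase hj)]

/-- The effect of a measurement in the computational basis on the state of a qubit. -/
def dephase (A : Matrix Bool Bool ℂ) : Matrix Bool Bool ℂ := fun x y => if x = y then A x y else 0

theorem act_meas_prodOp (G : BoolFun n m) (H : BoolFun m n) (i : Fin w)
    (A : Fin w → Matrix Bool Bool ℂ) :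
    (Gate.meas i).act G H (prodOp A) = prodOp (Function.update A i (dephase (A i))) := by
  ext b c
  have h := prodOp_update_apply A i (A i) b c
  rw [Function.update_eq_self] at h
  rw [prodOp_update_apply]
  change (if b i = c i then prodOp A b c else 0) = _
  rw [h, dephase]
  split_ifs <;> simp

theorem dephase_hadamard_bitProj (b : Bool) :
    dephase (hadamard * bitProj b * hadamard.conjTranspose) = (1 / 2 : ℂ) • 1 := by
  have h := inv_sqrt_two_mul_self
  have h' : (starRingEnd ℂ) ((Real.sqrt 2 : ℝ) : ℂ)⁻¹ = ((Real.sqrt 2 : ℝ) : ℂ)⁻¹ := by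
    rw [map_inv₀, Complex.conj_ofReal]
  ext x y
  simp only [dephase, Matrix.mul_apply, Fintype.sum_bool, hadamard, bitProj,
    Matrix.conjTranspose_apply, Matrix.smul_apply, Matrix.one_apply]
  generalize ((Real.sqrt 2 : ℝ) : ℂ)⁻¹ = r at h h'
  cases b <;> cases x <;> cases y <;> simp [h, h']

theorem onWires_controlled (e : Fin 2 ↪ Fin w) (U : Matrix Bool Bool ℂ) :
    onWires e (controlled U) = ∑ x, prodOp (Function.update
      (Function.update (fun _ => 1) (e 0) (bitProj x)) (e 1) (if x then U else 1)) := by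
  have h01 : e 0 ≠ e 1 := fun h => by simpa using e.injective h
  have hmem : e 0 ∈ Finset.univ.erase (e 1) := Finset.mem_erase.2 ⟨h01, Finset.mem_univ _⟩
  ext b c
  have hrest : ∏ j ∈ (Finset.univ.erase (e 1)).erase (e 0),
      (1 : Matrix Bool Bool ℂ) (b j) (c j) = if ∀ i, i ∉ Set.range e → b i = c i then 1 else 0 := by
    simp only [Matrix.one_apply]
    rw [Finset.prod_ite_zero, Finset.prod_const_one]
    congr 1
    rw [eq_iff_iff]
    refine forall_congr' fun i => ?_
    simp [Finset.mem_erase, Fin.exists_fin_two, eq_comm]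
  have hB : ∀ B B' : Matrix Bool Bool ℂ,
      prodOp (Function.update (Function.update (fun _ => 1) (e 0) B) (e 1) B') b c =
      B' (b (e 1)) (c (e 1)) * (B (b (e 0)) (c (e 0)) *
        if ∀ i, i ∉ Set.range e → b i = c i then 1 else 0) := fun B B' => by
    have hj : ∀ j ∈ (Finset.univ.erase (e 1)).erase (e 0),
        Function.update (fun _ => (1 : Matrix Bool Bool ℂ)) (e 0) B j (b j) (c j) =
          (1 : Matrix Bool Bool ℂ) (b j) (c j) := fun j hj => by
      rw [Function.update_of_ne (Finset.ne_of_mem_erase hj)]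
    rw [prodOp_update_apply, ← Finset.mul_prod_erase _ _ hmem, Function.update_self,
      Finset.prod_congr rfl hj, hrest]
  rw [Matrix.sum_apply, Fintype.sum_bool, hB, hB]
  simp only [onWires, controlled, bitProj]
  by_cases hr : ∀ i, i ∉ Set.range e → b i = c i
  · simp only [if_pos hr]
    cases b (e 0) <;> cases c (e 0) <;> simp [Matrix.one_apply]
  · simp only [if_neg hr, mul_zero, add_zero]

theorem onWires_controlled_mul_prodOp (e : Fin 2 ↪ Fin w) (U : Matrix Bool Bool ℂ)
    (A : Fin w → Matrix Bool Bool ℂ) {c : Bool} (hc : A (e 0) = bitProj c) :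
    onWires e (controlled U) * prodOp A =
      prodOp (Function.update A (e 1) ((if c then U else 1) * A (e 1))) := by
  have h01 : e 0 ≠ e 1 := fun h => by simpa using e.injective h
  rw [onWires_controlled, Finset.sum_mul]
  simp only [prodOp_mul]
  rw [Finset.sum_eq_single c]
  · congr 1
    funext j
    by_cases h1 : j = e 1
    · subst h1; simp
    · by_cases h0 : j = e 0
      · subst h0; simp [h01, hc, bitProj_mul]
      · simp [h0, h1]
  · intro x _ hx
    ext b b'
    have h0 : Function.update (Function.update (fun _ => (1 : Matrix Bool Bool ℂ)) (e 0) (bitProj x))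
        (e 1) (if x then U else 1) (e 0) * A (e 0) = 0 := by
      rw [Function.update_of_ne h01, Function.update_self, hc, bitProj_mul, if_neg hx]
    exact Finset.prod_eq_zero (Finset.mem_univ (e 0)) (congrFun (congrFun h0 _) _)
  · simp

theorem onWires_controlled_conj_prodOp (e : Fin 2 ↪ Fin w) (U : Matrix Bool Bool ℂ)
    (A : Fin w → Matrix Bool Bool ℂ) {c : Bool} (hc : A (e 0) = bitProj c) :
    onWires e (controlled U) * prodOp A * (onWires e (controlled U)).conjTranspose =
      prodOp (Function.update A (e 1)
        ((if c then U else 1) * A (e 1) * (if c then U else 1).conjTranspose)) := by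
  have h01 : e 0 ≠ e 1 := fun h => by simpa using e.injective h
  rw [onWires_controlled_mul_prodOp e U A hc, ← Matrix.conjTranspose_conjTranspose (prodOp _),
    ← Matrix.conjTranspose_mul, prodOp_conjTranspose, onWires_controlled_mul_prodOp e U _ (c := c)
      (by rw [Function.update_of_ne h01, hc, bitProj_conjTranspose]), prodOp_conjTranspose]
  congr 1
  funext j
  by_cases h1 : j = e 1
  · subst h1; cases c <;> simp [mul_assoc]
  · simp [h1]

theorem ketbra_conj (M : QOp w) (ψ : (Fin w → Bool) → ℂ) :
    M * ketbra ψ * M.conjTranspose = ketbra (M.mulVec ψ) := by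
  rw [ketbra, Matrix.mul_vecMulVec, Matrix.vecMulVec_mul, ketbra, Matrix.star_mulVec]

/-- A query on a basis state writes the answer of the oracle into the answer register. -/
theorem oracle_conj_ketbra_ket (e : Fin k ⊕ Fin l ↪ Fin w) (f : BoolFun k l) (x x' : Fin w → Bool)
    (hl : ∀ i, x' (e (.inl i)) = x (e (.inl i)))
    (hr : ∀ j, x' (e (.inr j)) = xor (x (e (.inr j))) (f (fun i => x (e (.inl i))) j))
    (ho : ∀ i, i ∉ Set.range e → x' i = x i) :
    onWires e (oracleMatrix f) * ketbra (ket x) * (onWires e (oracleMatrix f)).conjTranspose =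
      ketbra (ket x') := by
  rw [ketbra_conj]
  congr 1
  funext b
  rw [ket, Matrix.mulVec_single_one, Matrix.col_apply, ket, Pi.single_apply]
  simp only [onWires, oracleMatrix, ← ite_and]
  congr 1
  rw [eq_iff_iff]
  constructor
  · rintro ⟨h1, h2⟩
    funext i
    by_cases hi : i ∈ Set.range e
    · obtain ⟨j, rfl⟩ := hi
      have := congrFun h2 j
      rcases j with j | j
      · rw [hl]; exact this
      · rw [hr]; exact this
    · rw [h1 i hi, ho i hi]
  · rintro rfl
    refine ⟨ho, ?_⟩
    funext j
    rcases j with j | j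
    · exact hl j
    · exact hr j

/-- Hadamard gates followed by measurements turn qubits in basis states into uniformly random bits. -/
theorem gatesLin_had_meas {ι : Type} (G : BoolFun n m) (H : BoolFun m n) (t : ι ↪ Fin w) :
    ∀ (L : List ι), L.Nodup → ∀ (A A' : Fin w → Matrix Bool Bool ℂ),
      (∀ j ∈ L, ∃ b, A (t j) = bitProj b) → (∀ j ∈ L, A' (t j) = (1 / 2 : ℂ) • 1) →
      (∀ i, (∀ j ∈ L, i ≠ t j) → A' i = A i) →
      gatesLin G H (L.flatMap fun j => [.had (t j), .meas (t j)]) (prodOp A) = prodOp A' := by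
  intro L
  induction L with
  | nil =>
    intro _ A A' _ _ h
    rw [show A' = A from funext fun i => h i (by simp)]
    rfl
  | cons j L ih =>
    intro hnd A A' hA hA' ho
    rw [List.nodup_cons] at hnd
    obtain ⟨b, hb⟩ := hA j (by simp)
    have hne : ∀ j' ∈ L, t j' ≠ t j := fun j' hj' h => hnd.1 (t.injective h ▸ hj')
    change gatesLin G H (L.flatMap fun j => [.had (t j), .meas (t j)])
      ((Gate.meas (t j)).act G H ((Gate.had (t j)).act G H (prodOp A))) = _
    rw [show (Gate.had (t j)).act G H (prodOp A) = _ from onWire_conj_prodOp (t j) hadamard A,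
      act_meas_prodOp, Function.update_idem, Function.update_self, hb, dephase_hadamard_bitProj]
    refine ih hnd.2 _ _ (fun j' hj' => ?_) (fun j' hj' => hA' j' (by simp [hj'])) fun i hi => ?_
    · rw [Function.update_of_ne (hne j' hj')]
      exact hA j' (by simp [hj'])
    · by_cases h : i = t j
      · rw [h, Function.update_self, hA' j (by simp)]
      · rw [Function.update_of_ne h]
        exact ho i fun j' hj' => by
          rcases List.mem_cons.1 hj' with rfl | hj'
          exacts [h, hi j' hj']

/-- Controlled Hadamard gates with classical controls. -/
theorem gatesLin_chad {ι : Type} (G : BoolFun n m) (H : BoolFun m n) (e : ι → Fin 2 ↪ Fin w)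
    (θ : ι → Bool) (h01 : ∀ j j', e j 0 ≠ e j' 1) (h11 : ∀ j j', e j 1 = e j' 1 → j = j') :
    ∀ (L : List ι), L.Nodup → ∀ (A A' : Fin w → Matrix Bool Bool ℂ),
      (∀ j ∈ L, A (e j 0) = bitProj (θ j)) →
      (∀ j ∈ L, A' (e j 1) = (if θ j then hadamard else 1) * A (e j 1) *
        (if θ j then hadamard else 1).conjTranspose) →
      (∀ i, (∀ j ∈ L, i ≠ e j 1) → A' i = A i) →
      gatesLin G H (L.map fun j => .chad (e j)) (prodOp A) = prodOp A' := by
  intro L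
  induction L with
  | nil =>
    intro _ A A' _ _ h
    rw [show A' = A from funext fun i => h i (by simp)]
    rfl
  | cons j L ih =>
    intro hnd A A' hA hA' ho
    rw [List.nodup_cons] at hnd
    have hne : ∀ j' ∈ L, e j' 1 ≠ e j 1 := fun j' hj' h => hnd.1 (h11 _ _ h ▸ hj')
    change gatesLin G H (L.map fun j => .chad (e j)) ((Gate.chad (e j)).act G H (prodOp A)) = _
    rw [show (Gate.chad (e j)).act G H (prodOp A) = _ from
      onWires_controlled_conj_prodOp (e j) hadamard A (hA j (by simp))]
    refine ih hnd.2 _ _ (fun j' hj' => ?_) (fun j' hj' => ?_) fun i hi => ?_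
    · rw [Function.update_of_ne (h01 j' j)]
      exact hA j' (by simp [hj'])
    · rw [Function.update_of_ne (hne j' hj')]
      exact hA' j' (by simp [hj'])
    · by_cases h : i = e j 1
      · rw [h, Function.update_self, hA' j (by simp)]
      · rw [Function.update_of_ne h]
        exact ho i fun j' hj' => by
          rcases List.mem_cons.1 hj' with rfl | hj'
          exacts [h, hi j' hj']

theorem gatesLin_append (G : BoolFun n m) (H : BoolFun m n) (gs gs' : List (Gate n m w)) (ρ : QOp w) :
    gatesLin G H (gs ++ gs') ρ = gatesLin G H gs' (gatesLin G H gs ρ) := by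
  rw [← foldl_act_eq_gatesLin, List.foldl_append, foldl_act_eq_gatesLin, foldl_act_eq_gatesLin]

/-- The partial trace as a sum over the basis labels of the discarded wires. -/
theorem reduceTo_eq_sum (e : Fin k ↪ Fin w) [Fintype ({i // i ∉ Set.range e} → Bool)] (ρ : QOp w)
    (x y : Fin k → Bool) :
    reduceTo e ρ x y = ∑ r, ρ ((wireSplit e).symm (x, r)) ((wireSplit e).symm (y, r)) := by
  classical
  have key : ∀ p p' : (Fin k → Bool) × ({i // i ∉ Set.range e} → Bool),
      ((∀ j, (wireSplit e).symm p (e j) = x j) ∧ (∀ j, (wireSplit e).symm p' (e j) = y j) ∧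
        ∀ i, i ∉ Set.range e → (wireSplit e).symm p i = (wireSplit e).symm p' i) ↔
      p.1 = x ∧ p'.1 = y ∧ p.2 = p'.2 := by
    intro p p'
    have h1 : ∀ p j, (wireSplit e).symm p (e j) = p.1 j := fun p j =>
      congrFun (congrArg Prod.fst ((wireSplit e).apply_symm_apply p)) j
    have h2 : ∀ p (i : {i // i ∉ Set.range e}), (wireSplit e).symm p i = p.2 i := fun p i =>
      congrFun (congrArg Prod.snd ((wireSplit e).apply_symm_apply p)) i
    simp only [h1, funext_iff, Subtype.forall]
    refine and_congr_right fun _ => and_congr_right fun _ =>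
      forall_congr' fun i => forall_congr' fun hi => ?_
    rw [← h2 p ⟨i, hi⟩, ← h2 p' ⟨i, hi⟩]
  rw [reduceTo, ← (wireSplit e).symm.sum_comp, Fintype.sum_prod_type, Finset.sum_eq_single x]
  · refine Finset.sum_congr rfl fun r _ => ?_
    rw [← (wireSplit e).symm.sum_comp, Finset.sum_eq_single (y, r)]
    · exact if_pos ((key (x, r) (y, r)).2 ⟨rfl, rfl, rfl⟩)
    · rintro ⟨y', r'⟩ - hne
      refine if_neg fun h => hne ?_
      obtain ⟨-, h1, h2⟩ := (key _ _).1 h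
      exact Prod.ext h1 h2.symm
    · simp
  · intro x' _ hx
    refine Finset.sum_eq_zero fun r _ => Finset.sum_eq_zero fun c _ => ?_
    obtain ⟨p, rfl⟩ := (wireSplit e).symm.surjective c
    exact if_neg fun h => hx ((key _ _).1 h).1
  · simp

theorem reduceTo_prodOp (e : Fin k ↪ Fin w) (A : Fin w → Matrix Bool Bool ℂ)
    (hA : ∀ i, i ∉ Set.range e → (A i).trace = 1) :
    reduceTo e (prodOp A) = prodOp fun j => A (e j) := by
  classical
  funext x y
  rw [reduceTo_eq_sum]
  have h1 : ∀ (x : Fin k → Bool) (r : {i // i ∉ Set.range e} → Bool) j,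
      (wireSplit e).symm (x, r) (e j) = x j := fun x r j =>
    congrFun (congrArg Prod.fst ((wireSplit e).apply_symm_apply (x, r))) j
  have h2 : ∀ (x : Fin k → Bool) (r : {i // i ∉ Set.range e} → Bool) (i : {i // i ∉ Set.range e}),
      (wireSplit e).symm (x, r) i = r i := fun x r i =>
    congrFun (congrArg Prod.snd ((wireSplit e).apply_symm_apply (x, r))) i
  have h3 : ∀ r : {i // i ∉ Set.range e} → Bool,
      prodOp A ((wireSplit e).symm (x, r)) ((wireSplit e).symm (y, r)) =
        (∏ j, A (e j) (x j) (y j)) * ∏ i : {i // i ∉ Set.range e}, A i (r i) (r i) := fun r => by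
    rw [prodOp, ← Fintype.prod_subtype_mul_prod_subtype (· ∈ Set.range e)]
    congr 1
    · symm
      refine Finset.prod_bij (fun j _ => ⟨e j, j, rfl⟩) (fun _ _ => by simp)
        (fun j _ j' _ h => e.injective (Subtype.ext_iff.1 h)) ?_ fun j _ => by rw [h1, h1]
      rintro ⟨_, j, rfl⟩ -
      exact ⟨j, Finset.mem_univ _, rfl⟩
    · exact Finset.prod_congr rfl fun i _ => by rw [h2, h2]
  simp only [h3]
  have h4 := Finset.prod_univ_sum (fun _ : {i // i ∉ Set.range e} => (Finset.univ : Finset Bool))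
    fun i b => A i b b
  rw [Fintype.piFinset_univ] at h4
  have h5 : ∏ i : {i // i ∉ Set.range e}, ∑ b, A i b b = 1 :=
    Finset.prod_eq_one fun i _ => hA i.1 i.2
  rw [← Finset.mul_sum, ← h4, h5, mul_one]
  rfl

/-- Independent uniformly random bits on the wires selected by `e` are a mixture of basis states. -/
theorem prodOp_half_eq_sum (e : Fin k ↪ Fin w) (x : Fin w → Bool) (A : Fin w → Matrix Bool Bool ℂ)
    (hA : ∀ j, A (e j) = (1 / 2 : ℂ) • 1) (hA' : ∀ i, i ∉ Set.range e → A i = bitProj (x i))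
    (ow : (Fin k → Bool) → Fin w → Bool) (how : ∀ v j, ow v (e j) = v j)
    (how' : ∀ v i, i ∉ Set.range e → ow v i = x i) :
    prodOp A = ((2 : ℂ) ^ k)⁻¹ • ∑ v, ketbra (ket (ow v)) := by
  classical
  ext b c
  have h1 : prodOp A b c = ∏ i, (if i ∈ Set.range e then (1 / 2 : ℂ) else 1) *
      if b i = c i ∧ (i ∉ Set.range e → b i = x i) then 1 else 0 := by
    refine Finset.prod_congr rfl fun i _ => ?_
    by_cases h : i ∈ Set.range e
    · obtain ⟨j, rfl⟩ := h
      simp [hA, Matrix.one_apply]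
    · rw [hA' i h]
      simp only [h, if_false, not_false_eq_true, true_implies, one_mul, bitProj]
      congr 1
      rw [eq_iff_iff]
      constructor
      · rintro ⟨h1, h2⟩
        exact ⟨h1.trans h2.symm, h1⟩
      · rintro ⟨h1, h2⟩
        exact ⟨h2, h1.symm.trans h2⟩
  have h2 : (Finset.univ.filter (· ∈ Set.range e)).card = k := by
    have : Finset.univ.filter (· ∈ Set.range e) = Finset.univ.map e := by ext i; simp
    rw [this, Finset.card_map, Finset.card_univ, Fintype.card_fin]
  have h3 : ∀ v, (b = ow v ∧ c = ow v) ↔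
      v = (fun j => b (e j)) ∧ ∀ i, b i = c i ∧ (i ∉ Set.range e → b i = x i) := by
    intro v
    constructor
    · rintro ⟨rfl, rfl⟩
      exact ⟨funext fun j => (how v j).symm, fun i => ⟨rfl, how' v i⟩⟩
    · rintro ⟨rfl, h⟩
      obtain rfl : b = c := funext fun i => (h i).1
      refine and_self_iff.2 (funext fun i => ?_)
      by_cases hi : i ∈ Set.range e
      · obtain ⟨j, rfl⟩ := hi
        rw [how]
      · rw [how' _ _ hi, (h i).2 hi]
  rw [h1, Finset.prod_mul_distrib, Finset.prod_ite, Finset.prod_const, Finset.prod_const_one, h2,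
    Finset.prod_ite_zero, Finset.prod_const_one, Matrix.smul_apply, Matrix.sum_apply]
  simp only [ketbra_ket_apply, h3, Finset.mem_univ, true_implies]
  by_cases hP : ∀ i, b i = c i ∧ (i ∉ Set.range e → b i = x i)
  · rw [if_pos hP]
    simp only [and_iff_left hP]
    simp
  · rw [if_neg hP]
    simp only [hP, and_false, if_false]
    simp

end ProdOpGates

/-! ### The circuits for protection and simulation -/

section Circuits

variable (n m a : ℕ)

/-- `k` consecutive wires, starting with wire `s`. -/
def wireBlock (k s : ℕ) {w : ℕ} (h : s + k ≤ w) : Fin k ↪ Fin w where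
  toFun i := ⟨s + i, by omega⟩
  inj' i j hij := by simpa [Fin.ext_iff] using hij

theorem wireBlock_val {k s w : ℕ} (h : s + k ≤ w) (i : Fin k) : (wireBlock k s h i).val = s + i := rfl

/-- Two disjoint blocks of consecutive wires. -/
def wireBlocks (k s l t : ℕ) {w : ℕ} (h : s + k ≤ t) (h' : t + l ≤ w) : Fin k ⊕ Fin l ↪ Fin w where
  toFun := Sum.elim (wireBlock k s (by omega)) (wireBlock l t h')
  inj' := by
    rintro (i | i) (j | j) hij <;>
      simp only [Sum.elim_inl, Sum.elim_inr, Fin.ext_iff, wireBlock_val, Sum.inl.injEq,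
        Sum.inr.injEq, reduceCtorEq] at hij ⊢ <;> omega

/-- A pair of distinct wires. -/
def wirePair (s t : ℕ) {w : ℕ} (h : s < t) (h' : t < w) : Fin 2 ↪ Fin w where
  toFun := ![⟨s, by omega⟩, ⟨t, h'⟩]
  inj' := by
    intro i j hij
    fin_cases i <;> fin_cases j <;> simp [Fin.ext_iff] at hij ⊢ <;> omega

/-- The circuit that outputs `m + n` uniformly random bits: each of these qubits is measured after a
Hadamard gate. -/
def simCircuit : Circuit n m a (m + n) where
  anc := m + n
  gates := (List.finRange (m + n)).flatMap fun j =>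
    [.had (wireBlock (m + n) 0 (by omega) j), .meas (wireBlock (m + n) 0 (by omega) j)]
  out := wireBlock (m + n) 0 (by omega)

/-- The circuit for `CP.Protect`. The input `y` is on the first `n` wires, followed by `m` wires for
`θ = G(y)`, by `m` wires for `v` and by `n` wires for `z = H(v)`. -/
def protectCircuit : Circuit n m a (m + n) where
  anc := n + (m + (m + n))
  gates := [.queryG (wireBlocks n 0 m n (by omega) (by omega))] ++
    ((List.finRange m).flatMap fun j =>
      [.had (wireBlock m (n + m) (by omega) j), .meas (wireBlock m (n + m) (by omega) j)]) ++
    [.queryH (wireBlocks m (n + m) n (n + (m + m)) (by omega) (by omega))] ++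
    (List.finRange m).map fun j => .chad (wirePair (n + j) (n + m + j) (by omega) (by omega))
  out := wireBlock (m + n) (n + m) (by omega)

variable {n m}

theorem prodOp_half_one (k : ℕ) : prodOp (fun _ : Fin k => (1 / 2 : ℂ) • (1 : Matrix Bool Bool ℂ)) =
    maxMixed k := by
  ext b c
  have h : (1 : QOp k) b c = ∏ i, (1 : Matrix Bool Bool ℂ) (b i) (c i) :=
    (congrFun (congrFun prodOp_one b) c).symm
  simp only [prodOp, maxMixed, Matrix.smul_apply, h, smul_eq_mul, Finset.prod_mul_distrib]
  simp

theorem tens_prodOp {k l : ℕ} (A : Fin (k + l) → Matrix Bool Bool ℂ) :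
    prodOp A = tens (prodOp fun i => A (Fin.castAdd l i)) (prodOp fun j => A (Fin.natAdd k j)) := by
  ext b c
  simp only [tens, prodOp]
  rw [Fin.prod_univ_add]

theorem Circuit.run_mk {o : ℕ} (anc : ℕ) (gates : List (Gate n m (a + anc))) (out : Fin o ↪ Fin (a + anc))
    (G : BoolFun n m) (H : BoolFun m n) (ρ : QOp a) :
    (Circuit.mk anc gates out).run G H ρ =
      reduceTo out (gatesLin G H gates (tens ρ (ketbra (ket fun _ : Fin anc => false)))) :=
  congrArg _ (foldl_act_eq_gatesLin _ _ _ _)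

theorem reduceTo_smul_sum {ι : Type} [Fintype ι] {k w : ℕ} (e : Fin k ↪ Fin w) (r : ℂ)
    (ρ : ι → QOp w) : reduceTo e (r • ∑ i, ρ i) = r • ∑ i, reduceTo e (ρ i) := by
  classical
  funext x y
  rw [Matrix.smul_apply, Matrix.sum_apply]
  simp only [reduceTo_eq_sum, Matrix.smul_apply, Matrix.sum_apply, smul_eq_mul]
  rw [← Finset.mul_sum, Finset.sum_comm]

theorem simCircuit_run (G : BoolFun n m) (H : BoolFun m n) :
    (simCircuit n m 0).run G H (1 : QOp 0) = maxMixed (m + n) := by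
  have h0 : tens (1 : QOp 0) (ketbra (ket fun _ : Fin (m + n) => false)) =
      prodOp fun _ : Fin (0 + (m + n)) => bitProj false := by
    have h1 : (1 : QOp 0) = prodOp fun _ => bitProj false := by
      ext b c
      obtain rfl := Subsingleton.elim b c
      simp [prodOp]
    rw [ketbra_ket_eq_prodOp, h1]
    exact (tens_prodOp fun _ : Fin (0 + (m + n)) => bitProj false).symm
  have hw : ∀ i : Fin (0 + (m + n)), ∃ j, i = wireBlock (m + n) 0 (by omega) j := fun i =>
    ⟨⟨i, by omega⟩, Fin.ext (by simp [wireBlock])⟩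
  refine (Circuit.run_mk 0 (m + n) _ _ G H _).trans ?_
  rw [h0, gatesLin_had_meas G H (wireBlock (m + n) 0 (by omega)) _ (List.nodup_finRange _) _
    (fun _ => (1 / 2 : ℂ) • 1) (fun j _ => ⟨false, rfl⟩) (fun j _ => rfl) fun i hi => by
      obtain ⟨j, rfl⟩ := hw i
      exact absurd rfl (hi j (List.mem_finRange j)),
    reduceTo_prodOp _ _ fun i hi => by
      obtain ⟨j, rfl⟩ := hw i
      exact absurd ⟨j, rfl⟩ hi]
  exact prodOp_half_one _

theorem tens_ketbra_ket {k l : ℕ} (x : Fin k → Bool) (y : Fin l → Bool) :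
    tens (ketbra (ket x)) (ketbra (ket y)) = ketbra (ket (Fin.append x y)) := by
  rw [ketbra_ket_eq_prodOp, ketbra_ket_eq_prodOp, ketbra_ket_eq_prodOp]
  ext b c
  simp only [tens, prodOp]
  rw [Fin.prod_univ_add]
  simp

theorem bb84Qubit_eq (θ v : Bool) : (if θ then hadamard else 1) * bitProj v *
    (if θ then hadamard else (1 : Matrix Bool Bool ℂ)).conjTranspose = bb84Qubit θ v := by
  ext x y
  simp only [Matrix.mul_apply, Fintype.sum_bool, bb84Qubit, Matrix.vecMulVec_apply, Pi.star_apply,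
    Matrix.conjTranspose_apply, bitProj]
  cases v <;> simp

/-- The basis state of the register of the protection circuit in which the wires for `θ`, `v` and `z` hold
the given values. -/
def protectBits {w : ℕ} (y : Fin n → Bool) (θ v : Fin m → Bool) (z : Fin n → Bool) : Fin w → Bool :=
  fun i =>
    if h : i.val < n then y ⟨i, h⟩
    else if h : i.val - n < m then θ ⟨i - n, h⟩
    else if h : i.val - (n + m) < m then v ⟨i - (n + m), h⟩
    else if h : i.val - (n + (m + m)) < n then z ⟨i - (n + (m + m)), h⟩
    else false

section protectBits

variable {w : ℕ} (y : Fin n → Bool) (θ v : Fin m → Bool) (z : Fin n → Bool)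

theorem protectBits_y {i : Fin w} (j : Fin n) (h : i.val = j) : protectBits y θ v z i = y j := by
  simp [protectBits, h]

theorem protectBits_theta {i : Fin w} (j : Fin m) (h : i.val = n + j) :
    protectBits y θ v z i = θ j := by
  simp [protectBits, h]

theorem protectBits_v {i : Fin w} (j : Fin m) (h : i.val = n + m + j) :
    protectBits y θ v z i = v j := by
  have h1 : ¬ n + m + j.val < n := by omega
  have h2 : ¬ n + m + j.val - n < m := by omega
  simp [protectBits, h, h1, h2]

theorem protectBits_z {i : Fin w} (j : Fin n) (h : i.val = n + (m + m) + j) :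
    protectBits y θ v z i = z j := by
  have h1 : ¬ n + (m + m) + j.val < n := by omega
  have h2 : ¬ n + (m + m) + j.val - n < m := by omega
  have h3 : ¬ n + (m + m) + j.val - (n + m) < m := by omega
  simp [protectBits, h, h1, h2, h3]

theorem protectBits_congr {θ θ' v v' : Fin m → Bool} {z z' : Fin n → Bool} {i : Fin w}
    (h1 : n ≤ i.val → i.val < n + m → θ = θ') (h2 : n + m ≤ i.val → i.val < n + m + m → v = v')
    (h3 : n + (m + m) ≤ i.val → i.val < n + (m + m) + n → z = z') :
    protectBits y θ v z i = protectBits y θ' v' z' i := by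
  unfold protectBits
  split_ifs
  · rfl
  · rw [h1 (by omega) (by omega)]
  · rw [h2 (by omega) (by omega)]
  · rw [h3 (by omega) (by omega)]
  · rfl

end protectBits

theorem mem_range_wireBlock {k s w : ℕ} {h : s + k ≤ w} (i : Fin w) :
    i ∈ Set.range (wireBlock k s h) ↔ s ≤ i.val ∧ i.val < s + k := by
  constructor
  · rintro ⟨j, rfl⟩
    rw [wireBlock_val]
    omega
  · rintro ⟨h1, h2⟩
    exact ⟨⟨i - s, by omega⟩, Fin.ext (by rw [wireBlock_val]; simp only; omega)⟩

theorem mem_range_wireBlocks {k s l t w : ℕ} {h : s + k ≤ t} {h' : t + l ≤ w} (i : Fin w) :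
    i ∈ Set.range (wireBlocks k s l t h h') ↔
      (s ≤ i.val ∧ i.val < s + k) ∨ (t ≤ i.val ∧ i.val < t + l) := by
  rw [← mem_range_wireBlock (h := (by omega : s + k ≤ w)), ← mem_range_wireBlock (h := h')]
  exact Set.ext_iff.1 (Set.Sum.elim_range _ _) i

theorem protectCircuit_run (G : BoolFun n m) (H : BoolFun m n) (y : Fin n → Bool) :
    (protectCircuit n m n).run G H (ketbra (ket y)) = cpProtect G H y := by
  let F : Fin m → Bool := fun _ => false
  let Z : Fin n → Bool := fun _ => false
  let bits : (Fin m → Bool) → (Fin m → Bool) → (Fin n → Bool) →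
    Fin (n + (n + (m + (m + n)))) → Bool := protectBits y
  have h0 : Fin.append y (fun _ : Fin (n + (m + (m + n))) => false) = bits F F Z := by
    funext i
    refine Fin.addCases (fun i => ?_) (fun j => ?_) i
    · simp [bits, protectBits]
    · simp [bits, protectBits, F, Z]
  have s1 : gatesLin G H [.queryG (wireBlocks n 0 m n (by omega) (by omega))]
      (ketbra (ket (bits F F Z))) = ketbra (ket (bits (G y) F Z)) := by
    have hy : ∀ i, bits F F Z (wireBlocks n 0 m n (by omega) (by omega) (.inl i)) = y i := fun i =>
      protectBits_y _ _ _ _ _ (zero_add _)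
    refine oracle_conj_ketbra_ket _ _ _ _ (fun i => ?_) (fun j => ?_) fun i hi => ?_
    · rw [hy]
      exact protectBits_y _ _ _ _ _ (zero_add _)
    · simp only [hy]
      refine (protectBits_theta _ _ _ _ j rfl).trans ?_
      rw [show bits F F Z (wireBlocks n 0 m n (by omega) (by omega) (.inr j)) = false from
        protectBits_theta _ _ _ _ j rfl, Bool.false_xor]
    · rw [mem_range_wireBlocks] at hi
      exact protectBits_congr _ (by omega) (fun _ _ => rfl) fun _ _ => rfl
  have s2 : gatesLin G H ((List.finRange m).flatMap fun j =>
      [.had (wireBlock m (n + m) (by omega) j), .meas (wireBlock m (n + m) (by omega) j)])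
      (ketbra (ket (bits (G y) F Z))) =
        ((2 : ℂ) ^ m)⁻¹ • ∑ v, ketbra (ket (bits (G y) v Z)) := by
    classical
    rw [ketbra_ket_eq_prodOp, gatesLin_had_meas G H (wireBlock m (n + m) (by omega)) _
      (List.nodup_finRange _) _ (fun i => if i ∈ Set.range (wireBlock m (n + m) (by omega)) then
        (1 / 2 : ℂ) • 1 else bitProj (bits (G y) F Z i)) (fun j _ => ⟨_, rfl⟩)
      (fun j _ => if_pos ⟨j, rfl⟩) fun i hi => if_neg fun ⟨j, hj⟩ =>
        hi j (List.mem_finRange j) hj.symm]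
    refine prodOp_half_eq_sum (wireBlock m (n + m) (by omega)) (bits (G y) F Z) _
      (fun j => if_pos ⟨j, rfl⟩) (fun i hi => if_neg hi) _
      (fun v j => protectBits_v _ _ _ _ j rfl) fun v i hi => ?_
    rw [mem_range_wireBlock] at hi
    exact protectBits_congr _ (fun _ _ => rfl) (by omega) fun _ _ => rfl
  have s3 : ∀ v, gatesLin G H
      [.queryH (wireBlocks m (n + m) n (n + (m + m)) (by omega) (by omega))]
      (ketbra (ket (bits (G y) v Z))) = ketbra (ket (bits (G y) v (H v))) := by
    intro v
    have hv : ∀ z i, bits (G y) v z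
        (wireBlocks m (n + m) n (n + (m + m)) (by omega) (by omega) (.inl i)) = v i := fun z i =>
      protectBits_v _ _ _ _ _ rfl
    refine oracle_conj_ketbra_ket _ _ _ _ (fun i => ?_) (fun j => ?_) fun i hi => ?_
    · rw [hv, hv]
    · simp only [hv]
      refine (protectBits_z _ _ _ _ j rfl).trans ?_
      rw [show bits (G y) v Z (wireBlocks m (n + m) n (n + (m + m)) (by omega) (by omega) (.inr j)) =
        false from protectBits_z _ _ _ _ j rfl, Bool.false_xor]
    · rw [mem_range_wireBlocks] at hi
      exact protectBits_congr _ (fun _ _ => rfl) (fun _ _ => rfl) (by omega)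
  have s4 : ∀ v, reduceTo (wireBlock (m + n) (n + m) (by omega)) (gatesLin G H
      ((List.finRange m).map fun j : Fin m =>
        .chad (wirePair (n + j) (n + m + j) (by omega) (by omega)))
      (ketbra (ket (bits (G y) v (H v))))) = tens (ketbra (bb84 v (G y))) (ketbra (ket (H v))) := by
    intro v
    let A' : Fin (n + (n + (m + (m + n)))) → Matrix Bool Bool ℂ := fun i =>
      if h : n + m ≤ i.val ∧ i.val < n + m + m then
        bb84Qubit (G y ⟨i - (n + m), by omega⟩) (v ⟨i - (n + m), by omega⟩)
      else bitProj (bits (G y) v (H v) i)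
    have hA' : ∀ (i : Fin (n + (n + (m + (m + n))))) (j : Fin m), i.val = n + m + j →
        A' i = bb84Qubit (G y j) (v j) := fun i j hij => by
      have h : n + m ≤ i.val ∧ i.val < n + m + m := by omega
      simp only [A', dif_pos h, hij, Nat.add_sub_cancel_left]
    have hA0 : ∀ i : Fin (n + (n + (m + (m + n)))), ¬ (n + m ≤ i.val ∧ i.val < n + m + m) →
        A' i = bitProj (bits (G y) v (H v) i) := fun i hi => dif_neg hi
    rw [ketbra_ket_eq_prodOp, gatesLin_chad G H
      (fun j : Fin m => wirePair (n + j) (n + m + j) (by omega) (by omega)) (G y) ?_ ?_ _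
      (List.nodup_finRange _) _ A' ?_ ?_ ?_, reduceTo_prodOp]
    · rw [tens_prodOp, ketbra_bb84, ketbra_ket_eq_prodOp]
      congr 2
      · funext j
        exact hA' _ j rfl
      · funext j
        have hj : (wireBlock (m + n) (n + m) (by omega) (Fin.natAdd m j) :
            Fin (n + (n + (m + (m + n))))).val = n + (m + m) + j := by
          rw [wireBlock_val, Fin.val_natAdd]
          omega
        rw [hA0 _ (by omega)]
        exact congrArg bitProj (protectBits_z _ _ _ _ j hj)
    · intro i hi
      rw [mem_range_wireBlock] at hi
      rw [hA0 _ (by omega)]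
      simp [Matrix.trace, Matrix.diag, bitProj]
    · intro j j' h
      have : n + j.val = n + m + j'.val := Fin.ext_iff.1 h
      omega
    · intro j j' h
      have : n + m + j.val = n + m + j'.val := Fin.ext_iff.1 h
      exact Fin.ext (by omega)
    · intro j _
      exact congrArg bitProj (protectBits_theta _ _ _ _ j rfl)
    · intro j _
      rw [hA' _ j rfl, ← bb84Qubit_eq]
      rw [show bits (G y) v (H v) (wirePair (n + j) (n + m + j) (by omega) (by omega) 1) = v j from
        protectBits_v _ _ _ _ j rfl]
    · intro i hi
      refine hA0 i fun h => hi ⟨i - (n + m), by omega⟩ (List.mem_finRange _) (Fin.ext ?_)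
      change i.val = n + m + (i.val - (n + m))
      omega
  refine (Circuit.run_mk n (n + (m + (m + n))) _ _ G H _).trans ?_
  rw [tens_ketbra_ket, h0, gatesLin_append, gatesLin_append, gatesLin_append, s1, s2, map_smul,
    map_sum, map_smul, map_sum, cpProtect]
  rw [reduceTo_smul_sum]
  simp only [s3, s4]

end Circuits

/-! ### Uniformity of the circuits -/

theorem flatMap_finRange (k : ℕ) (g : ℕ → List Bool) :
    ((List.finRange k).flatMap fun i => g i.val) = (List.range k).flatMap g := by
  rw [← List.map_coe_finRange_eq_range, List.flatMap_map]

theorem wiresCode_eq {k w : ℕ} (e : Fin k → Fin w) (g : ℕ → ℕ) (h : ∀ i, (e i).val = g i) :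
    wiresCode e = (List.range k).flatMap fun i => unary (g i) := by
  rw [wiresCode, List.ofFn_eq_map, List.flatMap_map, ← flatMap_finRange]
  simp only [h]

theorem range_add_flatMap (k l : ℕ) (g : ℕ → List Bool) : (List.range (k + l)).flatMap g =
    (List.range k).flatMap g ++ (List.range l).flatMap fun i => g (k + i) := by
  rw [List.range_add, List.flatMap_append, List.flatMap_map]

theorem wiresCode_wirePair {s t w : ℕ} (h : s < t) (h' : t < w) :
    wiresCode (wirePair s t h h') = unary s ++ unary t := by
  simp only [wiresCode, List.ofFn_succ, List.ofFn_zero, List.flatMap_cons, List.flatMap_nil, List.append_nil]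
  rfl

theorem Circuit.code_mk {n m a o : ℕ} (anc : ℕ) (gates : List (Gate n m (a + anc)))
    (out : Fin o ↪ Fin (a + anc)) : (Circuit.mk anc gates out).code =
      unary anc ++ gates.flatMap Gate.code ++ unary 7 ++ wiresCode out := rfl

theorem simCircuit_code (n m a : ℕ) : (simCircuit n m a).code =
    unary (m + n) ++ (List.range (m + n)).flatMap (fun i => unary 0 ++ unary i ++ (unary 4 ++ unary i)) ++
      unary 7 ++ (List.range (m + n)).flatMap fun i => unary i := by
  refine (Circuit.code_mk (m + n) _ _).trans ?_
  simp only [List.flatMap_assoc, List.flatMap_cons, List.flatMap_nil, List.append_nil, Gate.code,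
    wireBlock_val, zero_add]
  rw [wiresCode_eq _ (fun i => i) fun i => zero_add _,
    flatMap_finRange (m + n) fun i => unary 0 ++ unary i ++ (unary 4 ++ unary i)]

theorem protectCircuit_code (n m a : ℕ) : (protectCircuit n m a).code =
    unary (n + (m + (m + n))) ++ ((unary 5 ++ (List.range n).flatMap (fun i => unary i) ++
      (List.range m).flatMap fun i => unary (n + i)) ++
      (List.range m).flatMap (fun i => unary 0 ++ unary (n + m + i) ++ (unary 4 ++ unary (n + m + i))) ++
      (unary 6 ++ (List.range m).flatMap (fun i => unary (n + m + i)) ++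
        (List.range n).flatMap fun i => unary (n + (m + m) + i)) ++
      (List.range m).flatMap fun i => unary 3 ++ (unary (n + i) ++ unary (n + m + i))) ++
      unary 7 ++ (List.range (m + n)).flatMap fun i => unary (n + m + i) := by
  refine (Circuit.code_mk (n + (m + (m + n))) _ _).trans ?_
  simp only [List.flatMap_append, List.flatMap_assoc, List.flatMap_map, List.flatMap_cons,
    List.flatMap_nil, List.append_nil, Gate.code, wireBlock_val, wiresCode_wirePair]
  rw [wiresCode_eq _ (fun i => i) fun i => zero_add _, wiresCode_eq _ (fun i => n + i) fun i => rfl,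
    wiresCode_eq _ (fun i => n + m + i) fun i => rfl,
    wiresCode_eq _ (fun i => n + (m + m) + i) fun i => rfl,
    wiresCode_eq _ (fun i => n + m + i) fun i => rfl,
    flatMap_finRange m fun i => unary 0 ++ unary (n + m + i) ++ (unary 4 ++ unary (n + m + i)),
    flatMap_finRange m fun i => unary 3 ++ (unary (n + i) ++ unary (n + m + i))]

theorem printable_index {S : ℕ → ℕ → ℕ → Prop} (hS : ∀ N i k, S N i k → i ≤ N) :
    Printable S fun _ _ _ i => List.replicate i true := .reg 3 (by omega) hS

theorem printable_n {S : ℕ → ℕ → ℕ → Prop} (hS : ∀ N i k, S N i k → i ≤ N) :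
    Printable S fun n _ _ _ => List.replicate n true := .reg 0 (by omega) hS

theorem printable_m {S : ℕ → ℕ → ℕ → Prop} (hS : ∀ N i k, S N i k → i ≤ N) :
    Printable S fun _ m _ _ => List.replicate m true := .reg 1 (by omega) hS

theorem inLoop_le (N i k : ℕ) (h : InLoop N i k) : i ≤ N := h

theorem outsideLoops_le (N i k : ℕ) (h : OutsideLoops N i k) : i ≤ N := h.1 ▸ Nat.zero_le N

theorem Printable.range_n {f : ℕ → ℕ → ℕ → ℕ → List Bool} (hf : Printable InLoop f) :
    Printable OutsideLoops fun n m a _ => (List.range n).flatMap (f n m a) := hf.forLoop 0 (by omega)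

theorem Printable.range_m {f : ℕ → ℕ → ℕ → ℕ → List Bool} (hf : Printable InLoop f) :
    Printable OutsideLoops fun n m a _ => (List.range m).flatMap (f n m a) := hf.forLoop 1 (by omega)

theorem simCircuit_uniform : PolyTimePrintable fun n m a => (simCircuit n m a).code := by
  have hi := (printable_index inLoop_le)
  have him := ((printable_m inLoop_le).replicate_add hi)
  have hg : ∀ {g : ℕ → ℕ → ℕ → ℕ → ℕ}, (Printable InLoop fun n m a i => List.replicate (g n m a i) true) →
      Printable InLoop fun n m a i => unary 0 ++ unary (g n m a i) ++ (unary 4 ++ unary (g n m a i)) :=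
    fun h => ((Printable.lit _).append h.unary).append ((Printable.lit _).append h.unary)
  have h := ((((printable_m outsideLoops_le).replicate_add (printable_n outsideLoops_le)).unary.append
    ((hg hi).range_m.append (hg him).range_n)).append (.lit (unary 7))).append
    (hi.unary.range_m.append him.unary.range_n)
  simp only [simCircuit_code, range_add_flatMap]
  exact h.polyTimePrintable

theorem protectCircuit_uniform : PolyTimePrintable fun n m a => (protectCircuit n m a).code := by
  have hi := (printable_index inLoop_le)
  have hn := (printable_n inLoop_le)
  have hm := (printable_m inLoop_le)
  have hni := hn.replicate_add hi
  have hnmi := (hn.replicate_add hm).replicate_add hi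
  have hnmmi := (hn.replicate_add (hm.replicate_add hm)).replicate_add hi
  have hnmi' := (hn.replicate_add hm).replicate_add (hm.replicate_add hi)
  have hn0 := (printable_n outsideLoops_le)
  have hm0 := (printable_m outsideLoops_le)
  have h := ((((hn0.replicate_add (hm0.replicate_add (hm0.replicate_add hn0))).unary.append
    (((((Printable.lit (unary 5)).append hi.unary.range_n).append hni.unary.range_m).append
      (((Printable.lit (unary 0)).append hnmi.unary).append
        ((Printable.lit (unary 4)).append hnmi.unary)).range_m).append
      (((Printable.lit (unary 6)).append hnmi.unary.range_m).append hnmmi.unary.range_n) |>.append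
      ((Printable.lit (unary 3)).append (hni.unary.append hnmi.unary)).range_m)).append
    (.lit (unary 7)))).append (hnmi.unary.range_m.append hnmi'.unary.range_n)
  simp only [protectCircuit_code, range_add_flatMap]
  exact h.polyTimePrintable

/-! ### Copy protection of point functions -/

theorem mainTheorem8 (m : ℕ → ℕ) (hm : ∀ n, n < m n) (hpoly : PolyBounded m) :
    (∃ A : QPTAlgorithm (fun n k _ => k + n), ∀ (n : ℕ) (G : BoolFun n (m n)) (H : BoolFun (m n) n)
      (y : Fin n → Bool), A.run G H (ketbra (ket y)) = cpProtect G H y) ∧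
    DistributionallyIndistinguishable m (fun n k => k + n) (fun _ G H y => cpProtect G H y)
      UnpredictablePF ∧
    ∀ D ∈ UnpredictablePF,
      CompIndistQROM m (fun n => m n + n)
        (fun n G H => avgState (D n) (fun y => cpProtect G H y))
        (fun n _ _ => maxMixed (m n + n)) := by
  refine ⟨⟨⟨protectCircuit, protectCircuit_uniform⟩, fun n => protectCircuit_run⟩,
    ⟨⟨simCircuit, simCircuit_uniform⟩, fun D hD => ?_⟩,
    fun D hD => compIndistQROM_maxMixed hm hpoly hD⟩
  have h := compIndistQROM_maxMixed hm hpoly hD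
  rwa [show (fun n (_ : BoolFun n (m n)) (_ : BoolFun (m n) n) => maxMixed (m n + n)) =
    fun n G H => (simCircuit n (m n) 0).run G H 1 from
      funext fun n => funext fun G => funext fun H => (simCircuit_run G H).symm] at h
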